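/- For complex numbers, let powers be principal, and let the continued fraction $1+\frac{a_1}{b_1+\frac{a_2}{b_2+\cdots}}$ be understood to halt just before its first vanishing partial numerator. It "has the value $v$" if its convergents have non-zero denominators from some index on and tend to $v$. (For a continued fraction that has halted, later convergents repeat the last one.) For $n,x\in\mathbb{C}$ let $$\mathcal L(n,x)=1+\cfrac{nx}{1+\cfrac{(1-n)x}{2+\cfrac{(1+n)x}{3+\cfrac{(2-n)x}{2+\cfrac{(2+n)x}{5+\cfrac{(3-n)x}{2+\cfrac{(3+n)x}{7+\cdots}}}}}}}$$ be Lagrange's continued fraction, and for $n,z\in\mathbb{C}$ let $$\mathcal E(n,z)=1+\cfrac{(n^2-1)z^2}{3+\cfrac{(n^2-4)z^2}{5+\cfrac{(n^2-9)z^2}{7+\cdots}}},\qquad F(n,z)=\frac{nz\,[(1+z)^n+(1-z)^n]}{(1+z)^n-(1-z)^n}.$$ Write $\mathcal L_k,\mathcal E_k$ for the $k$-th convergents, i.e. those using the first $k$ partial quotients ($\mathcal L_0=\mathcal E_0=1$). Then: 1. (Lagrange's expansion) If $1+x\notin(-\infty,0]$, then $\mathcal L(n,x)$ has the value $(1+x)^n$.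 2. (Contraction and substitution) Let $n\neq 0$, $z\ne 0,1$, and put $y=\frac{z}{1-z}$, $x=2y$. For every $k\ge 0$ for which the denominators of the convergents $\mathcal L_{2k+2}(n,x)$ and $\mathcal E_k(n,z)$ are non-zero, $\mathcal L_{2k+2}(n,x)\neq 1$ and $$nz\,\frac{\mathcal L_{2k+2}(n,x)+1}{\mathcal L_{2k+2}(n,x)-1}=\mathcal E_k(n,z).$$ 3. (Main continued fraction) If $1+z\notin(-\infty,0]$, $1-z\notin(-\infty,0]$ and $(1+z)^n\ne(1-z)^n$, then $\mathcal E(n,z)$ has the value $F(n,z)$, that is, $$\frac{nz\,[(1+z)^n+(1-z)^n]}{(1+z)^n-(1-z)^n}=1+\cfrac{(n^2-1)z^2}{3+\cfrac{(n^2-4)z^2}{5+\cfrac{(n^2-9)z^2}{7+\cdots}}}.$$ 4. (Termination) If $n=\pm m$ with an integer $m\ge 1$, then for every $z\in\mathbb{C}$ the continued fraction $\mathcal E(n,z)$ has halted after at most $m-1$ partial quotients; and if $(1+z)^n\neq(1-z)^n$ (and, when $n=-m$, also $z\ne\pm1$), then the convergent $\mathcal E_{m-1}(n,z)$ has non-zero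 denominator and equals $F(n,z)$. 5. (Invariance) If $z\neq\pm1$ and $(1+z)^n\ne(1-z)^n$, then $(1+z)^{-n}\neq(1-z)^{-n}$ and $F(-n,z)=F(n,z)$. -/

import Mathlib

open Filter Topology

/-- The continued fraction `h + a 0 / (b 0 + a 1 / (b 1 + a 2 / (b 2 + ⋯)))`, which halts just
before its first vanishing partial numerator (if there is one). -/
noncomputable def haltingContFract (h : ℂ) (a b : ℕ → ℂ) : GenContFract ℂ where
  h := h
  s := ⟨fun k => open Classical in if ∃ j ≤ k, a j = 0 then none else some ⟨a k, b k⟩, by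
    intro k hk
    have hz : ∃ j ≤ k, a j = 0 := by
      by_contra hne
      simp [hne] at hk
    obtain ⟨j, hj, hz⟩ := hz
    exact if_pos ⟨j, Nat.le_succ_of_le hj, hz⟩⟩

/-- Lagrange's continued fraction
`1 + n x / (1 + (1 - n) x / (2 + (1 + n) x / (3 + (2 - n) x / (2 + (2 + n) x / (5 + ⋯)))))`.
The entries at an even position `2 j` are `(j + n) x` and `2 j + 1`,
those at an odd position `2 j + 1` are `(j + 1 - n) x` and `2`. -/
noncomputable def lagrangeContFract (n x : ℂ) : GenContFract ℂ :=
  haltingContFract 1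
    (fun k => if Even k then (((k / 2 : ℕ) : ℂ) + n) * x else (((k / 2 : ℕ) : ℂ) + 1 - n) * x)
    (fun k => if Even k then (k : ℂ) + 1 else 2)

/-- The continued fraction
`1 + (n² - 1) z² / (3 + (n² - 4) z² / (5 + (n² - 9) z² / (7 + ⋯)))`. -/
noncomputable def eulerContFract (n z : ℂ) : GenContFract ℂ :=
  haltingContFract 1 (fun k => (n ^ 2 - ((k : ℂ) + 1) ^ 2) * z ^ 2) (fun k => 2 * (k : ℂ) + 3)

/-- The left member `n z [(1 + z)^n + (1 - z)^n] / [(1 + z)^n - (1 - z)^n]` (principal powers). -/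
noncomputable def eulerLeftMember (n z : ℂ) : ℂ :=
  n * z * ((1 + z) ^ n + (1 - z) ^ n) / ((1 + z) ^ n - (1 - z) ^ n)

/-- The continued fraction `g` has the value `v`: its convergents are eventually defined
(nonzero denominators) and tend to `v`. -/
def ContFractHasValue (g : GenContFract ℂ) (v : ℂ) : Prop :=
  (∀ᶠ k in atTop, g.dens k ≠ 0) ∧ Tendsto g.convs atTop (𝓝 v)

/-!
Both continued fractions are studied through the linear recurrence
`y (k + 2) = b k * y (k + 1) + a k * y k` of their numerators and denominators (`threeTerm`).

*Lagrange's expansion.* With `L = log (1 + x)`, the tails of Lagrange's fraction are, without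
division, the integrals `(1 / k!) ∫ t ^ k (1 - t) ^ k (1 + t x) ^ (n - k - 1) dt` and
`(1 / k!) ∫ t ^ k (1 - t) ^ (k + 1) (1 + t x) ^ (n - k - 2) dt` over a path from `0` to `1`;
integration by parts gives their recurrence (`lagrangeTail_recurrence`). Hence the remainder
`(1 + x) ^ n * B k - A k` is, up to sign, a product of partial numerators times such an integral
(`threeTerm_remainder`). If a partial numerator vanishes, so does the remainder, and the non-zero
Casoratian makes the last convergent exact (`haltingContFract_value_of_eq_zero`). Otherwise the
normalised recurrence has the limiting characteristic roots `(1 ± s) / 2` with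
`s = exp (L / 2)`, of different moduli. A solution that is `o(ρ ^ k)` for some `ρ` below the larger
modulus is negligible against every independent one (`tendsto_div_of_recessive`), so it suffices to
bound the integrals. The path `1 + t x = exp (σ L)`, `0 ≤ σ ≤ 1`, passes through the saddle point
`1 + t x = s`, and along it the bound reduces to `|cosh l - cosh (τ l)| < |1 + cosh l|` for
`|Im l| < π / 2` and `|τ| ≤ 1` (`Complex.norm_cosh_sub_cosh_lt`).

*Euler's fraction.* For `x = 2 z / (1 - z)` the even part of Lagrange's recurrence is Euler's
recurrence up to powers of `(1 - z) / 2`, and Euler's numerators and denominators are proportional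
to `n z (A + B)` and `A - B` (`exists_euler_eq_lagrange`). As `1 + x = (1 + z) / (1 - z)`, where
the principal powers are compatible with the quotient (`div_mem_slitPlane_and_cpow`), the value of
Euler's fraction follows. In the terminating case `n = m` the cross-multiplied identity extends
by continuity to `z = ±1`, and the Casoratian again excludes a vanishing denominator.
-/

/-! ### Numerators, denominators and halting -/

/-- The sequence with `y 0 = u`, `y 1 = v` and `y (k + 2) = b k * y (k + 1) + a k * y k`.
With `(u, v) = (1, h)` and `(0, 1)` its term of index `k + 1` is the `k`-th numerator and
denominator of `h + a 0 / (b 0 + a 1 / (b 1 + ⋯))`, where no halting takes place. -/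
def threeTerm (a b : ℕ → ℂ) (u v : ℂ) : ℕ → ℂ
  | 0 => u
  | 1 => v
  | k + 2 => b k * threeTerm a b u v (k + 1) + a k * threeTerm a b u v k

section Halting

variable {h : ℂ} {a b : ℕ → ℂ}

theorem haltingContFract_get?_of_ne {k : ℕ} (hk : ∀ i ≤ k, a i ≠ 0) :
    (haltingContFract h a b).s.get? k = some ⟨a k, b k⟩ := by
  have : ¬ ∃ j ≤ k, a j = 0 := by push Not; exact hk
  exact if_neg this

theorem haltingContFract_terminatedAt {k K : ℕ} (hk : a K = 0) (hKk : K ≤ k) :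
    (haltingContFract h a b).TerminatedAt k :=
  if_pos ⟨K, hKk, hk⟩

theorem haltingContFract_contsAux (k : ℕ) (hk : ∀ i, i + 1 < k → a i ≠ 0) :
    (haltingContFract h a b).contsAux k = ⟨threeTerm a b 1 h k, threeTerm a b 0 1 k⟩ := by
  induction k using Nat.strong_induction_on with
  | _ k ih =>
    match k with
    | 0 => rfl
    | 1 => rfl
    | k + 2 =>
      rw [GenContFract.contsAux_recurrence
        (haltingContFract_get?_of_ne fun i hi => hk i (by omega))
        (ih k (by omega) fun i hi => hk i (by omega))
        (ih (k + 1) (by omega) fun i hi => hk i (by omega))]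
      rfl

theorem haltingContFract_conts {k : ℕ} (hk : ∀ i < k, a i ≠ 0) :
    (haltingContFract h a b).conts k =
      ⟨threeTerm a b 1 h (k + 1), threeTerm a b 0 1 (k + 1)⟩ :=
  haltingContFract_contsAux (k + 1) fun i hi => hk i (by omega)

theorem haltingContFract_nums {k : ℕ} (hk : ∀ i < k, a i ≠ 0) :
    (haltingContFract h a b).nums k = threeTerm a b 1 h (k + 1) := by
  rw [GenContFract.num_eq_conts_a, haltingContFract_conts hk]

theorem haltingContFract_dens {k : ℕ} (hk : ∀ i < k, a i ≠ 0) :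
    (haltingContFract h a b).dens k = threeTerm a b 0 1 (k + 1) := by
  rw [GenContFract.den_eq_conts_b, haltingContFract_conts hk]

/-- The Casoratian of numerators and denominators is, up to sign, the product of the partial
numerators. -/
theorem threeTerm_casoratian_ne_zero {k : ℕ} (hk : ∀ i < k, a i ≠ 0) :
    threeTerm a b 1 h (k + 1) * threeTerm a b 0 1 k
      - threeTerm a b 1 h k * threeTerm a b 0 1 (k + 1) ≠ 0 := by
  induction k with
  | zero => simp [threeTerm]
  | succ k ih =>
    have h1 := mul_ne_zero (neg_ne_zero.2 (hk k (by omega))) (ih fun i hi => hk i (by omega))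
    convert h1 using 1
    simp only [threeTerm]
    ring

/-- A remainder `f * B - A` is a product of partial numerators times a sequence `J` of tails:
`J (k + 1) / J k` is the value of the continued fraction `1 / (b k + a (k + 1) / (b (k + 1) + ⋯))`,
expressed without division. -/
theorem threeTerm_remainder {f : ℂ} {J : ℕ → ℂ} (h0 : J 0 = 1) (h1 : f = h + a 0 * J 1)
    (hJ : ∀ k, J k = b k * J (k + 1) + a (k + 1) * J (k + 2)) (k : ℕ) :
    f * threeTerm a b 0 1 k - threeTerm a b 1 h k =
      -(∏ i ∈ Finset.range k, -a i) * J k := by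
  induction k using Nat.strong_induction_on with
  | _ k ih =>
    match k with
    | 0 => simp [threeTerm, h0]
    | 1 => simp [threeTerm, h1]
    | k + 2 =>
      have e1 := ih k (by omega)
      have e2 := ih (k + 1) (by omega)
      rw [Finset.prod_range_succ] at e2
      rw [Finset.prod_range_succ, Finset.prod_range_succ]
      simp only [threeTerm]
      rw [hJ k] at e1
      linear_combination b k * e2 + a k * e1

/-- If tails exist as in `threeTerm_remainder` and some partial numerator vanishes, the halted
continued fraction takes the value `f` exactly: the remainder vanishes, and the Casoratian
prevents the denominator from vanishing with it. -/
theorem haltingContFract_value_of_eq_zero {f : ℂ} {J : ℕ → ℂ} (h0 : J 0 = 1)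
    (h1 : f = h + a 0 * J 1)
    (hJ : ∀ k, J k = b k * J (k + 1) + a (k + 1) * J (k + 2)) {K : ℕ}
    (hK : a K = 0) (hlt : ∀ i < K, a i ≠ 0) :
    (haltingContFract h a b).dens K ≠ 0 ∧
      (haltingContFract h a b).nums K = f * (haltingContFract h a b).dens K := by
  have hr := threeTerm_remainder h0 h1 hJ (K + 1)
  rw [Finset.prod_range_succ, hK] at hr
  simp only [neg_zero, mul_zero, zero_mul, sub_eq_zero] at hr
  rw [haltingContFract_nums hlt, haltingContFract_dens hlt]
  refine ⟨fun hB => threeTerm_casoratian_ne_zero (h := h) (b := b) hlt ?_, hr.symm⟩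
  rw [← hr, hB]
  ring

theorem contFractHasValue_of_terminatedAt {g : GenContFract ℂ} {K : ℕ} {f : ℂ}
    (hK : g.TerminatedAt K) (hB : g.dens K ≠ 0) (hA : g.nums K = f * g.dens K) :
    ContFractHasValue g f := by
  constructor
  · filter_upwards [eventually_ge_atTop K] with k hk
    rwa [GenContFract.dens_stable_of_terminated hk hK]
  · refine tendsto_const_nhds.congr' ?_
    filter_upwards [eventually_ge_atTop K] with k hk
    rw [GenContFract.convs_stable_of_terminated hk hK, GenContFract.conv_eq_num_div_den, hA,
      mul_div_cancel_right₀ _ hB]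

end Halting

/-! ### Lagrange's and Euler's continued fractions and the contraction -/

/-- The partial numerators of Lagrange's continued fraction. -/
noncomputable def lagrangeNum (n x : ℂ) (k : ℕ) : ℂ :=
  if Even k then (((k / 2 : ℕ) : ℂ) + n) * x else (((k / 2 : ℕ) : ℂ) + 1 - n) * x

/-- The partial denominators of Lagrange's continued fraction. -/
noncomputable def lagrangeDen (k : ℕ) : ℂ := if Even k then (k : ℂ) + 1 else 2

/-- The partial numerators of Euler's continued fraction. -/
noncomputable def eulerNum (n z : ℂ) (k : ℕ) : ℂ := (n ^ 2 - ((k : ℂ) + 1) ^ 2) * z ^ 2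

/-- The partial denominators of Euler's continued fraction. -/
noncomputable def eulerDen (k : ℕ) : ℂ := 2 * (k : ℂ) + 3

theorem lagrangeContFract_eq (n x : ℂ) :
    lagrangeContFract n x = haltingContFract 1 (lagrangeNum n x) lagrangeDen := rfl

theorem eulerContFract_eq (n z : ℂ) :
    eulerContFract n z = haltingContFract 1 (eulerNum n z) eulerDen := rfl

theorem lagrangeNum_even (n x : ℂ) (k : ℕ) : lagrangeNum n x (2 * k) = (k + n) * x := by
  simp [lagrangeNum]

theorem lagrangeNum_odd (n x : ℂ) (k : ℕ) : lagrangeNum n x (2 * k + 1) = (k + 1 - n) * x := by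
  have : (2 * k + 1) / 2 = k := by omega
  simp [lagrangeNum, this]

theorem lagrangeDen_even (k : ℕ) : lagrangeDen (2 * k) = 2 * k + 1 := by
  simp [lagrangeDen]

theorem lagrangeDen_odd (k : ℕ) : lagrangeDen (2 * k + 1) = 2 := by
  simp [lagrangeDen]

/-- The even part of the recurrence of Lagrange's continued fraction. -/
theorem threeTerm_lagrange_even (n x u v : ℂ) (k : ℕ) :
    threeTerm (lagrangeNum n x) lagrangeDen u v (2 * k + 5) =
      (2 * k + 3) * (2 + x) * threeTerm (lagrangeNum n x) lagrangeDen u v (2 * k + 3) +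
      (n ^ 2 - (k + 1) ^ 2) * x ^ 2 * threeTerm (lagrangeNum n x) lagrangeDen u v (2 * k + 1) := by
  set Y := threeTerm (lagrangeNum n x) lagrangeDen u v with hY
  have e0 : Y (2 * k + 3) = 2 * Y (2 * k + 2) + (k + 1 - n) * x * Y (2 * k + 1) := by
    rw [← lagrangeDen_odd k, ← lagrangeNum_odd n x]; rfl
  have e1 : Y (2 * k + 4) =
      (2 * k + 3) * Y (2 * k + 3) + (k + 1 + n) * x * Y (2 * k + 2) := by
    have hd := lagrangeDen_even (k + 1)
    have hn := lagrangeNum_even n x (k + 1)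
    push_cast at hd hn
    rw [← hn, show (2 * k + 3 : ℂ) = 2 * (k + 1) + 1 by ring, ← hd]; rfl
  have e2 : Y (2 * k + 5) = 2 * Y (2 * k + 4) + (k + 2 - n) * x * Y (2 * k + 3) := by
    have hd := lagrangeDen_odd (k + 1)
    have hn := lagrangeNum_odd n x (k + 1)
    push_cast at hn
    rw [show (k + 2 - n : ℂ) = k + 1 + 1 - n by ring, ← hn, ← hd]; rfl
  linear_combination e2 + 2 * e1 - (k + 1 + n) * x * e0

/-- With `x = 2 z / (1 - z)`, i.e. `x (1 - z) = 2 z`, the even part of Lagrange's recurrence is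
Euler's recurrence up to the factors `((1 - z) / 2) ^ k`. -/
theorem threeTerm_euler_eq {n z x : ℂ} (hx : x * (1 - z) = 2 * z) (k : ℕ) :
    2 * n * z * threeTerm (eulerNum n z) eulerDen 1 1 k =
      ((1 - z) / 2) ^ k * (n * z * (threeTerm (lagrangeNum n x) lagrangeDen 1 1 (2 * k + 1) +
        threeTerm (lagrangeNum n x) lagrangeDen 0 1 (2 * k + 1))) ∧
    2 * n * z * threeTerm (eulerNum n z) eulerDen 0 1 k =
      ((1 - z) / 2) ^ k * (threeTerm (lagrangeNum n x) lagrangeDen 1 1 (2 * k + 1) -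
        threeTerm (lagrangeNum n x) lagrangeDen 0 1 (2 * k + 1)) := by
  have h2 : (2 + x) * (1 - z) = 2 := by linear_combination hx
  have h3 : x ^ 2 * (1 - z) ^ 2 = 4 * z ^ 2 := by
    linear_combination (x * (1 - z) + 2 * z) * hx
  have e0 := lagrangeDen_even 0
  have e1 := lagrangeDen_odd 0
  have e2 := lagrangeNum_even n x 0
  have e3 := lagrangeNum_odd n x 0
  simp only [mul_zero, zero_add, Nat.cast_zero] at e0 e1 e2 e3
  induction k using Nat.strong_induction_on with
  | _ k ih =>
    match k with
    | 0 => exact ⟨by simp [threeTerm]; ring, by simp [threeTerm]⟩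
    | 1 =>
      constructor <;> simp only [threeTerm, e0, e1, e2, e3]
      · linear_combination -n * z * h2
      · linear_combination -n * hx
    | k + 2 =>
      obtain ⟨a1, a2⟩ := ih k (by omega)
      obtain ⟨b1, b2⟩ := ih (k + 1) (by omega)
      rw [show 2 * (k + 1) + 1 = 2 * k + 3 by ring] at b1 b2
      have hE (u v : ℂ) : threeTerm (eulerNum n z) eulerDen u v (k + 2) =
          (2 * k + 3) * threeTerm (eulerNum n z) eulerDen u v (k + 1) +
          (n ^ 2 - (k + 1) ^ 2) * z ^ 2 * threeTerm (eulerNum n z) eulerDen u v k := rfl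
      rw [show 2 * (k + 2) + 1 = 2 * k + 5 by ring, threeTerm_lagrange_even,
        threeTerm_lagrange_even, hE, hE]
      clear ih
      generalize threeTerm (lagrangeNum n x) lagrangeDen 1 1 = P at *
      generalize threeTerm (lagrangeNum n x) lagrangeDen 0 1 = Q at *
      rw [pow_succ ((1 - z) / 2)] at b1 b2
      rw [pow_succ ((1 - z) / 2) (k + 1), pow_succ ((1 - z) / 2) k]
      generalize ((1 - z) / 2) ^ k = q at *
      constructor
      · linear_combination (2 * k + 3) * b1 + (n ^ 2 - (k + 1) ^ 2) * z ^ 2 * a1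
          - (2 * k + 3) * (q * ((1 - z) / 2) * (n * z * (P (2 * k + 3) + Q (2 * k + 3)))) / 2 * h2
          - (n ^ 2 - (k + 1) ^ 2) * (q * (n * z * (P (2 * k + 1) + Q (2 * k + 1)))) / 4 * h3
      · linear_combination (2 * k + 3) * b2 + (n ^ 2 - (k + 1) ^ 2) * z ^ 2 * a2
          - (2 * k + 3) * (q * ((1 - z) / 2) * (P (2 * k + 3) - Q (2 * k + 3))) / 2 * h2
          - (n ^ 2 - (k + 1) ^ 2) * (q * (P (2 * k + 1) - Q (2 * k + 1))) / 4 * h3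

theorem eulerNum_eq_zero_iff {n z : ℂ} (hz : z ≠ 0) (k : ℕ) :
    eulerNum n z k = 0 ↔ n = k + 1 ∨ n = -(k + 1) := by
  simp [eulerNum, hz, sub_eq_zero, sq_eq_sq_iff_eq_or_eq_neg]

theorem lagrangeNum_ne_zero {n x z : ℂ} (hn : n ≠ 0) (hx : x ≠ 0) (hz : z ≠ 0) {k : ℕ}
    (hk : ∀ i < k, eulerNum n z i ≠ 0) {i : ℕ} (hi : i < 2 * k + 1) : lagrangeNum n x i ≠ 0 := by
  obtain ⟨j, rfl | rfl⟩ := Nat.even_or_odd' i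
  · rw [lagrangeNum_even]
    refine mul_ne_zero ?_ hx
    match j with
    | 0 => simpa using hn
    | j + 1 =>
      intro h0
      refine hk j (by omega) ((eulerNum_eq_zero_iff hz j).2 (Or.inr ?_))
      push_cast at h0
      linear_combination h0
  · rw [lagrangeNum_odd]
    refine mul_ne_zero (fun h0 => ?_) hx
    exact hk j (by omega) ((eulerNum_eq_zero_iff hz j).2 (Or.inl (by linear_combination -h0)))

/-- The contraction for the halting continued fractions: up to a common non-zero factor, the
numerators and denominators of Euler's continued fraction are `n z (A + B)` and `A - B`, where
`A / B` runs through the even convergents of Lagrange's. -/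
theorem exists_euler_eq_lagrange {n z x : ℂ} (hn : n ≠ 0) (hz : z ≠ 0) (hz1 : z ≠ 1)
    (hx : x * (1 - z) = 2 * z) (k : ℕ) :
    ∃ c : ℂ, c ≠ 0 ∧
      c * (eulerContFract n z).nums k = n * z *
        ((lagrangeContFract n x).nums (2 * k + 2) + (lagrangeContFract n x).dens (2 * k + 2)) ∧
      c * (eulerContFract n z).dens k =
        (lagrangeContFract n x).nums (2 * k + 2) - (lagrangeContFract n x).dens (2 * k + 2) := by
  have hx0 : x ≠ 0 := by
    rintro rfl
    apply hz
    linear_combination -hx / 2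
  have hz1' : (1 - z) / 2 ≠ 0 := div_ne_zero (sub_ne_zero.2 hz1.symm) two_ne_zero
  rw [eulerContFract_eq, lagrangeContFract_eq]
  have key : ∀ k, (∀ i < k, eulerNum n z i ≠ 0) → ∃ c : ℂ, c ≠ 0 ∧
      c * (haltingContFract 1 (eulerNum n z) eulerDen).nums k = n * z *
        ((haltingContFract 1 (lagrangeNum n x) lagrangeDen).nums (2 * k + 2) +
          (haltingContFract 1 (lagrangeNum n x) lagrangeDen).dens (2 * k + 2)) ∧
      c * (haltingContFract 1 (eulerNum n z) eulerDen).dens k =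
        (haltingContFract 1 (lagrangeNum n x) lagrangeDen).nums (2 * k + 2) -
          (haltingContFract 1 (lagrangeNum n x) lagrangeDen).dens (2 * k + 2) := by
    intro k hk
    have hl : ∀ i < 2 * k + 1, lagrangeNum n x i ≠ 0 := fun i hi =>
      lagrangeNum_ne_zero hn hx0 hz hk hi
    obtain ⟨e1, e2⟩ := threeTerm_euler_eq (n := n) hx (k + 1)
    rw [show 2 * (k + 1) + 1 = 2 * k + 2 + 1 by ring] at e1 e2
    rw [haltingContFract_nums hk, haltingContFract_dens hk]
    have hq : ((1 - z) / 2) ^ (k + 1) ≠ 0 := pow_ne_zero _ hz1'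
    by_cases h0 : lagrangeNum n x (2 * k + 1) = 0
    · -- Lagrange's fraction halts one step early; its recurrence then just doubles both terms
      have ht := haltingContFract_terminatedAt (h := 1) (b := lagrangeDen) h0 le_rfl
      rw [GenContFract.nums_stable_of_terminated (Nat.le_succ _) ht,
        GenContFract.dens_stable_of_terminated (Nat.le_succ _) ht,
        haltingContFract_nums hl, haltingContFract_dens hl]
      simp only [threeTerm, h0, lagrangeDen_odd, zero_mul, add_zero] at e1 e2 ⊢
      refine ⟨n * z / ((1 - z) / 2) ^ (k + 1),
        div_ne_zero (mul_ne_zero hn hz) hq, ?_, ?_⟩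
      · rw [div_mul_eq_mul_div, div_eq_iff hq]
        linear_combination e1 / 2
      · rw [div_mul_eq_mul_div, div_eq_iff hq]
        linear_combination e2 / 2
    · have hl' : ∀ i < 2 * k + 2, lagrangeNum n x i ≠ 0 := by
        intro i hi
        rcases Nat.lt_succ_iff_lt_or_eq.1 hi with h | rfl
        · exact hl i h
        · exact h0
      rw [haltingContFract_nums hl', haltingContFract_dens hl']
      refine ⟨2 * n * z / ((1 - z) / 2) ^ (k + 1),
        div_ne_zero (mul_ne_zero (mul_ne_zero two_ne_zero hn) hz) hq, ?_, ?_⟩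
      · rw [div_mul_eq_mul_div, div_eq_iff hq]
        linear_combination e1
      · rw [div_mul_eq_mul_div, div_eq_iff hq]
        linear_combination e2
  by_cases hk : ∀ i < k, eulerNum n z i ≠ 0
  · exact key k hk
  · push Not at hk
    classical
    have hex : ∃ i, eulerNum n z i = 0 := hk.imp fun _ h => h.2
    obtain ⟨i, hik, hi⟩ := hk
    set K := Nat.find hex with hK
    have hK0 : eulerNum n z K = 0 := Nat.find_spec hex
    have hKk : K ≤ k := (Nat.find_min' hex hi).trans hik.le
    have hL : (haltingContFract 1 (lagrangeNum n x) lagrangeDen).TerminatedAt (2 * K + 2) := by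
      rcases (eulerNum_eq_zero_iff hz K).1 hK0 with h | h
      · refine haltingContFract_terminatedAt (K := 2 * K + 1) ?_ (by omega)
        rw [lagrangeNum_odd, h]; ring
      · refine haltingContFract_terminatedAt (K := 2 * (K + 1)) ?_ (by omega)
        rw [lagrangeNum_even, h]; push_cast; ring
    have hE := haltingContFract_terminatedAt (h := 1) (b := eulerDen) hK0 le_rfl
    rw [GenContFract.nums_stable_of_terminated hKk hE,
      GenContFract.dens_stable_of_terminated hKk hE,
      GenContFract.nums_stable_of_terminated (by omega : 2 * K + 2 ≤ 2 * k + 2) hL,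
      GenContFract.dens_stable_of_terminated (by omega : 2 * K + 2 ≤ 2 * k + 2) hL]
    exact key K fun i hi => Nat.find_min hex hi

/-! ### Integral formulas for the tails of Lagrange's continued fraction -/

/-- The integral `∫ t ^ p (1 - t) ^ q (1 + t x) ^ (c - 1) dt` from `0` to `1`, taken along the path
`1 + t x = exp (σ L)`, `σ ∈ [0, 1]`, where `exp L = 1 + x`. -/
noncomputable def powerIntegral (x L : ℂ) (p q : ℕ) (c : ℂ) : ℂ :=
  ∫ σ in (0 : ℝ)..1, ((Complex.exp (σ * L) - 1) / x) ^ p *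
    (1 - (Complex.exp (σ * L) - 1) / x) ^ q * Complex.exp (c * (σ * L)) * (L / x)

section PowerIntegral

variable {x L : ℂ}

theorem continuous_powerIntegrand (p q : ℕ) (c : ℂ) :
    Continuous fun σ : ℝ => ((Complex.exp (σ * L) - 1) / x) ^ p *
      (1 - (Complex.exp (σ * L) - 1) / x) ^ q * Complex.exp (c * (σ * L)) * (L / x) := by
  fun_prop

theorem powerIntegral_exp_add_one (hx : x ≠ 0) (p q : ℕ) (c : ℂ) :
    powerIntegral x L p q (c + 1) = powerIntegral x L p q c + x * powerIntegral x L (p + 1) q c := by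
  unfold powerIntegral
  rw [← intervalIntegral.integral_const_mul, ← intervalIntegral.integral_add
    ((continuous_powerIntegrand _ _ _).intervalIntegrable _ _)
    (((continuous_powerIntegrand _ _ _).intervalIntegrable _ _).const_mul _)]
  congr 1 with σ
  have hE : Complex.exp (σ * L) = 1 + x * ((Complex.exp (σ * L) - 1) / x) := by field_simp; ring
  rw [add_mul c, Complex.exp_add, one_mul]
  generalize (Complex.exp (σ * L) - 1) / x = t at *
  rw [hE]
  ring

theorem powerIntegral_right_succ (p q : ℕ) (c : ℂ) :
    powerIntegral x L p (q + 1) c = powerIntegral x L p q c - powerIntegral x L (p + 1) q c := by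
  unfold powerIntegral
  rw [← intervalIntegral.integral_sub
    ((continuous_powerIntegrand _ _ _).intervalIntegrable _ _)
    ((continuous_powerIntegrand _ _ _).intervalIntegrable _ _)]
  congr 1 with σ
  ring

/-- Integration by parts: the integral of the derivative of `t ^ p (1 - t) ^ (q + 1) (1 + t x) ^ c`,
whose boundary term at `t = 1` vanishes. -/
theorem powerIntegral_by_parts (hx : x ≠ 0) (hL : Complex.exp L = 1 + x) (p q : ℕ) (c : ℂ) :
    p * powerIntegral x L (p - 1) (q + 1) (c + 1) - (q + 1) * powerIntegral x L p q (c + 1) +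
      c * x * powerIntegral x L p (q + 1) c = -(0 : ℂ) ^ p := by
  have hder : ∀ σ : ℝ, HasDerivAt (fun σ : ℝ => ((Complex.exp (σ * L) - 1) / x) ^ p *
      (1 - (Complex.exp (σ * L) - 1) / x) ^ (q + 1) * Complex.exp (c * (σ * L)))
      (p * (((Complex.exp (σ * L) - 1) / x) ^ (p - 1) *
      (1 - (Complex.exp (σ * L) - 1) / x) ^ (q + 1) * Complex.exp ((c + 1) * (σ * L)) * (L / x)) -
      (q + 1) * (((Complex.exp (σ * L) - 1) / x) ^ p *
      (1 - (Complex.exp (σ * L) - 1) / x) ^ q * Complex.exp ((c + 1) * (σ * L)) * (L / x)) +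
      c * x * (((Complex.exp (σ * L) - 1) / x) ^ p *
      (1 - (Complex.exp (σ * L) - 1) / x) ^ (q + 1) * Complex.exp (c * (σ * L)) * (L / x))) σ := by
    intro σ
    have h0 : HasDerivAt (fun σ : ℝ => (σ : ℂ) * L) L σ := by
      simpa using (Complex.ofRealCLM.hasDerivAt (x := σ)).mul_const L
    have h1 : HasDerivAt (fun σ : ℝ => (Complex.exp (σ * L) - 1) / x)
        (Complex.exp (σ * L) * L / x) σ := (h0.cexp.sub_const 1).div_const x
    have h2 := ((h1.pow p).mul ((h1.const_sub 1).pow (q + 1))).mul (h0.const_mul c).cexp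
    refine h2.congr_deriv ?_
    rw [add_mul c, Complex.exp_add, one_mul]
    simp only [Pi.mul_apply, Pi.pow_apply, Nat.add_sub_cancel]
    have hLx : L = x * (L / x) := by field_simp
    generalize (Complex.exp (σ * L) - 1) / x = t at *
    push_cast
    simp only [mul_div_assoc]
    generalize L / x = m at *
    linear_combination
      (c * t ^ p * (1 - t) ^ (q + 1) * Complex.exp (c * (σ * L))) * hLx
  have hint := fun p q c => (continuous_powerIntegrand (x := x) (L := L) p q c).intervalIntegrable
    (μ := MeasureTheory.volume) 0 1
  have := intervalIntegral.integral_eq_sub_of_hasDerivAt (a := 0) (b := 1)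
    (fun σ _ => hder σ) ((((hint _ _ _).const_mul _).sub ((hint _ _ _).const_mul _)).add
      ((hint _ _ _).const_mul _))
  rw [intervalIntegral.integral_add (((hint _ _ _).const_mul _).sub ((hint _ _ _).const_mul _))
      ((hint _ _ _).const_mul _),
    intervalIntegral.integral_sub ((hint _ _ _).const_mul _) ((hint _ _ _).const_mul _),
    intervalIntegral.integral_const_mul, intervalIntegral.integral_const_mul,
    intervalIntegral.integral_const_mul] at this
  unfold powerIntegral
  rw [this]
  simp [hL, div_self hx]

/-- The tails of Lagrange's continued fraction as integrals: `J 0 = 1`,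
`J (2 k + 1) = (1 / k!) ∫ t ^ k (1 - t) ^ k (1 + t x) ^ (n - k - 1) dt` and
`J (2 k + 2) = (1 / k!) ∫ t ^ k (1 - t) ^ (k + 1) (1 + t x) ^ (n - k - 2) dt`. -/
noncomputable def lagrangeTail (n x L : ℂ) : ℕ → ℂ
  | 0 => 1
  | k + 1 => if Even k
      then powerIntegral x L (k / 2) (k / 2) (n - (k / 2 : ℕ)) / (k / 2).factorial
      else powerIntegral x L (k / 2) (k / 2 + 1) (n - 1 - (k / 2 : ℕ)) / (k / 2).factorial

theorem lagrangeTail_odd (n x L : ℂ) (k : ℕ) : lagrangeTail n x L (2 * k + 1) =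
    powerIntegral x L k k (n - k) / k.factorial := by
  simp [lagrangeTail]

theorem lagrangeTail_even (n x L : ℂ) (k : ℕ) : lagrangeTail n x L (2 * k + 2) =
    powerIntegral x L k (k + 1) (n - 1 - k) / k.factorial := by
  have : (2 * k + 1) / 2 = k := by omega
  simp [lagrangeTail, this]

theorem exp_eq_lagrangeTail (hx : x ≠ 0) (n : ℂ) :
    Complex.exp (n * L) = 1 + lagrangeNum n x 0 * lagrangeTail n x L 1 := by
  have h0 : lagrangeNum n x 0 = n * x := by simpa using lagrangeNum_even n x 0
  have h1 : lagrangeTail n x L 1 = powerIntegral x L 0 0 n := by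
    simpa using lagrangeTail_odd n x L 0
  rw [h0, h1]
  have hder : ∀ σ : ℝ, HasDerivAt (fun σ : ℝ => Complex.exp (n * (σ * L)))
      (n * x * (((Complex.exp (σ * L) - 1) / x) ^ 0 *
      (1 - (Complex.exp (σ * L) - 1) / x) ^ 0 * Complex.exp (n * (σ * L)) * (L / x))) σ := by
    intro σ
    have h0 : HasDerivAt (fun σ : ℝ => (σ : ℂ) * L) L σ := by
      simpa using (Complex.ofRealCLM.hasDerivAt (x := σ)).mul_const L
    refine (h0.const_mul n).cexp.congr_deriv ?_
    field_simp
  have := intervalIntegral.integral_eq_sub_of_hasDerivAt (a := 0) (b := 1)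
    (fun σ _ => hder σ) (((continuous_powerIntegrand (x := x) (L := L) 0 0 n).intervalIntegrable
      0 1).const_mul _)
  rw [intervalIntegral.integral_const_mul] at this
  unfold powerIntegral
  rw [this]
  simp

theorem lagrangeTail_recurrence (hx : x ≠ 0) (hL : Complex.exp L = 1 + x) (n : ℂ) (k : ℕ) :
    lagrangeTail n x L k = lagrangeDen k * lagrangeTail n x L (k + 1) +
      lagrangeNum n x (k + 1) * lagrangeTail n x L (k + 2) := by
  obtain ⟨j, rfl | rfl⟩ := Nat.even_or_odd' k
  · rw [lagrangeTail_odd, lagrangeTail_even, lagrangeDen_even, lagrangeNum_odd]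
    have hp := powerIntegral_by_parts hx hL j j (n - 1 - j)
    have hf : (j.factorial : ℂ) ≠ 0 := by exact_mod_cast j.factorial_ne_zero
    match j with
    | 0 =>
      simp only [lagrangeTail, Nat.factorial]
      simp at hp ⊢
      linear_combination hp
    | j + 1 =>
      rw [show 2 * (j + 1) = 2 * j + 2 by ring, lagrangeTail_even]
      have hr := powerIntegral_right_succ (x := x) (L := L) j (j + 1) (n - 1 - j)
      have hf' : (j.factorial : ℂ) ≠ 0 := by exact_mod_cast j.factorial_ne_zero
      rw [Nat.factorial_succ] at hf ⊢
      push_cast at hp hf hr ⊢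
      rw [show n - 1 - (j + 1 : ℂ) + 1 = n - 1 - j by ring] at hp
      rw [show n - (j + 1 : ℂ) = n - 1 - j by ring]
      simp only [pow_succ, mul_zero, neg_zero] at hp
      rw [hr] at hp
      have hj : (j + 1 : ℂ) ≠ 0 := by exact_mod_cast j.succ_ne_zero
      field_simp
      linear_combination hp
  · rw [show 2 * j + 1 + 1 = 2 * j + 2 by ring, show 2 * j + 1 + 2 = 2 * (j + 1) + 1 by ring,
      lagrangeTail_odd, lagrangeTail_even, lagrangeTail_odd, lagrangeDen_odd,
      show 2 * j + 2 = 2 * (j + 1) by ring, lagrangeNum_even]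
    have hp := powerIntegral_by_parts hx hL (j + 1) j (n - 1 - j)
    have hf : (j.factorial : ℂ) ≠ 0 := by exact_mod_cast j.factorial_ne_zero
    have hj : (j + 1 : ℂ) ≠ 0 := by exact_mod_cast j.succ_ne_zero
    have hc : n - (j + 1 : ℕ) = n - 1 - j := by push_cast; ring
    have hc' : n - j = n - 1 - j + 1 := by ring
    rw [hc, hc', powerIntegral_exp_add_one hx]
    simp only [Nat.add_sub_cancel, pow_succ, mul_zero, neg_zero] at hp
    rw [powerIntegral_exp_add_one hx, powerIntegral_exp_add_one hx] at hp
    have r1 := powerIntegral_right_succ (x := x) (L := L) j j (n - 1 - j)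
    have r2 := powerIntegral_right_succ (x := x) (L := L) (j + 1) j (n - 1 - j)
    rw [Nat.factorial_succ]
    push_cast at hp hf ⊢
    field_simp
    rw [r1, r2] at *
    linear_combination -hp
end PowerIntegral

/-! ### Recessive solutions of three-term recurrences -/

section Growth

variable {α : ℕ → ℂ} {l₁ l₂ : ℂ}

/-- In a recurrence `y (k + 2) = y (k + 1) + α k * y k` with `α k → -l₁ * l₂`, `l₁ + l₂ = 1` and
`|l₂| < |l₁|`, put `u k = y (k + 1) - l₂ * y k` and `v k = y (k + 1) - l₁ * y k`. From some index
on, the cone `|v| ≤ |u|` is preserved, and a solution inside it grows at least like `ρ ^ k`, for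
any given `ρ < |l₁|`. -/
theorem exists_dominant_cone (hl : l₁ + l₂ = 1) (hlt : ‖l₂‖ < ‖l₁‖)
    (hα : Tendsto α atTop (𝓝 (-(l₁ * l₂)))) {ρ : ℝ} (hρ : ρ < ‖l₁‖) :
    ∃ N, ∀ y : ℕ → ℂ, (∀ k, y (k + 2) = y (k + 1) + α k * y k) → ∀ k ≥ N,
      ‖y (k + 1) - l₁ * y k‖ ≤ ‖y (k + 1) - l₂ * y k‖ →
      ‖y (k + 2) - l₁ * y (k + 1)‖ ≤ ‖y (k + 2) - l₂ * y (k + 1)‖ ∧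
      ρ * ‖y (k + 1) - l₂ * y k‖ ≤ ‖y (k + 2) - l₂ * y (k + 1)‖ := by
  have hd : l₁ - l₂ ≠ 0 := by
    intro h
    rw [sub_eq_zero.1 h] at hlt
    exact lt_irrefl _ hlt
  have hd' : 0 < ‖l₁ - l₂‖ := norm_pos_iff.2 hd
  -- the size of the perturbation `α k + l₁ l₂` that both estimates tolerate
  set ε := min ((‖l₁‖ - ‖l₂‖) / 4) ((‖l₁‖ - ρ) / 2) * ‖l₁ - l₂‖ with hε
  have hεpos : 0 < ε := mul_pos (lt_min (by linarith) (by linarith)) hd'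
  obtain ⟨N, hN⟩ := (Metric.tendsto_atTop.1 hα) ε hεpos
  refine ⟨N, fun y hy k hk huv => ?_⟩
  have hαk : ‖α k + l₁ * l₂‖ < ε := by
    have := hN k hk
    rwa [dist_eq_norm, sub_neg_eq_add] at this
  set u := y (k + 1) - l₂ * y k with hu
  set v := y (k + 1) - l₁ * y k with hv
  have hyk : y k = (u - v) / (l₁ - l₂) := by
    rw [eq_div_iff hd, hu, hv]; ring
  have hu' : y (k + 2) - l₂ * y (k + 1) = l₁ * u + (α k + l₁ * l₂) * y k := by
    rw [hy, hu]; linear_combination (-y (k + 1)) * hl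
  have hv' : y (k + 2) - l₁ * y (k + 1) = l₂ * v + (α k + l₁ * l₂) * y k := by
    rw [hy, hv]; linear_combination (-y (k + 1)) * hl
  set δ := min ((‖l₁‖ - ‖l₂‖) / 4) ((‖l₁‖ - ρ) / 2)
  have hδ1 : δ ≤ (‖l₁‖ - ‖l₂‖) / 4 := min_le_left _ _
  have hδ2 : δ ≤ (‖l₁‖ - ρ) / 2 := min_le_right _ _
  have herr : ‖(α k + l₁ * l₂) * y k‖ ≤ δ * (2 * ‖u‖) := by
    rw [hyk, norm_mul, norm_div]
    have h1 : ‖u - v‖ ≤ 2 * ‖u‖ := (norm_sub_le _ _).trans (by linarith)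
    calc ‖α k + l₁ * l₂‖ * (‖u - v‖ / ‖l₁ - l₂‖)
        ≤ ε * ((2 * ‖u‖) / ‖l₁ - l₂‖) := by gcongr
      _ = δ * (2 * ‖u‖) := by rw [hε]; field_simp
  have hU : ‖l₁‖ * ‖u‖ - δ * (2 * ‖u‖) ≤ ‖y (k + 2) - l₂ * y (k + 1)‖ := by
    rw [hu', ← norm_mul]
    have := norm_sub_le_norm_add (l₁ * u) ((α k + l₁ * l₂) * y k)
    linarith
  have hV : ‖y (k + 2) - l₁ * y (k + 1)‖ ≤ ‖l₂‖ * ‖u‖ + δ * (2 * ‖u‖) := by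
    rw [hv']
    refine (norm_add_le _ _).trans (add_le_add ?_ herr)
    rw [norm_mul]
    gcongr
  have hun := norm_nonneg u
  constructor
  · refine hV.trans (le_trans ?_ hU)
    nlinarith
  · refine le_trans ?_ hU
    nlinarith

/-- Two solutions of a recurrence as in `exists_dominant_cone` with non-vanishing Casoratian: if
one of them is `o(ρ ^ k)` for some `ρ < |l₁|`, then it is negligible against the other. -/
theorem tendsto_div_of_recessive (hl : l₁ + l₂ = 1) (hlt : ‖l₂‖ < ‖l₁‖)
    (hα : Tendsto α atTop (𝓝 (-(l₁ * l₂)))) {ρ : ℝ} (hρ0 : 0 < ρ) (hρ : ρ < ‖l₁‖)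
    {B R : ℕ → ℂ} (hB : ∀ k, B (k + 2) = B (k + 1) + α k * B k)
    (hR : ∀ k, R (k + 2) = R (k + 1) + α k * R k)
    (hRρ : Tendsto (fun k => R k / (ρ : ℂ) ^ k) atTop (𝓝 0))
    (hcas : ∀ k, R (k + 1) * B k - R k * B (k + 1) ≠ 0) :
    (∀ᶠ k in atTop, B k ≠ 0) ∧ Tendsto (fun k => R k / B k) atTop (𝓝 0) := by
  obtain ⟨N, hN⟩ := exists_dominant_cone hl hlt hα hρ
  have hd : l₁ - l₂ ≠ 0 := by
    intro h
    rw [sub_eq_zero.1 h] at hlt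
    exact lt_irrefl _ hlt
  have hd' : 0 < ‖l₁ - l₂‖ := norm_pos_iff.2 hd
  -- a solution that starts on the axis of the cone grows at least like `ρ ^ k`
  have grow : ∀ y : ℕ → ℂ, (∀ k, y (k + 2) = y (k + 1) + α k * y k) →
      y (N + 1) - l₁ * y N = 0 → y (N + 1) - l₂ * y N ≠ 0 →
      ∃ c > 0, ∀ k ≥ N + 1, c * ρ ^ k ≤ ‖y k‖ := by
    intro y hy hv hu
    have h1 : ∀ j, ‖y (N + j + 1) - l₁ * y (N + j)‖ ≤ ‖y (N + j + 1) - l₂ * y (N + j)‖ ∧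
        ρ ^ j * ‖y (N + 1) - l₂ * y N‖ ≤ ‖y (N + j + 1) - l₂ * y (N + j)‖ := by
      intro j
      induction j with
      | zero => simp [hv]
      | succ j ih =>
        obtain ⟨a1, a2⟩ := hN y hy (N + j) (by omega) ih.1
        refine ⟨a1, le_trans ?_ a2⟩
        rw [pow_succ]
        nlinarith [mul_le_mul_of_nonneg_left ih.2 hρ0.le]
    have h3 : 0 < ‖l₁‖ - ‖l₂‖ := by linarith
    have h4 : 0 < ‖y (N + 1) - l₂ * y N‖ := norm_pos_iff.2 hu
    refine ⟨(‖l₁‖ - ‖l₂‖) / ‖l₁ - l₂‖ * ‖y (N + 1) - l₂ * y N‖ / ρ ^ (N + 1), by positivity, ?_⟩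
    intro k hk
    obtain ⟨j, rfl⟩ := Nat.exists_eq_add_of_le hk
    obtain ⟨b1, b2⟩ := h1 j
    rw [show N + 1 + j = N + j + 1 by ring]
    set u := y (N + j + 1) - l₂ * y (N + j) with hu
    set v := y (N + j + 1) - l₁ * y (N + j) with hv
    have hyk : (l₁ - l₂) * y (N + j + 1) = l₁ * u - l₂ * v := by rw [hu, hv]; ring
    have b3 : (‖l₁‖ - ‖l₂‖) * ‖u‖ ≤ ‖l₁ - l₂‖ * ‖y (N + j + 1)‖ := by
      rw [← norm_mul, hyk]
      refine le_trans ?_ (norm_sub_norm_le _ _)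
      rw [norm_mul, norm_mul]
      nlinarith [mul_le_mul_of_nonneg_left b1 (norm_nonneg l₂)]
    have b4 := mul_le_mul_of_nonneg_left b2 h3.le
    calc (‖l₁‖ - ‖l₂‖) / ‖l₁ - l₂‖ * ‖y (N + 1) - l₂ * y N‖ / ρ ^ (N + 1) * ρ ^ (N + j + 1)
        = (‖l₁‖ - ‖l₂‖) * (ρ ^ j * ‖y (N + 1) - l₂ * y N‖) / ‖l₁ - l₂‖ := by
          field_simp; ring
      _ ≤ ‖y (N + j + 1)‖ := by
          rw [div_le_iff₀ hd']
          linarith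
  -- hence `R` does not start on that axis
  have hvR : R (N + 1) - l₁ * R N ≠ 0 := by
    intro hv
    have hu : R (N + 1) - l₂ * R N ≠ 0 := by
      intro hu
      have h0 : R N = 0 := by
        have : (l₁ - l₂) * R N = 0 := by linear_combination hu - hv
        exact (mul_eq_zero.1 this).resolve_left hd
      apply hcas N
      rw [sub_eq_zero.1 hv, h0]
      ring
    obtain ⟨c, hc, hgrow⟩ := grow R hR hv hu
    have h1 : ∀ᶠ k in atTop, ‖R k / (ρ : ℂ) ^ k‖ < c := by
      have := hRρ.norm
      rw [norm_zero] at this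
      exact this.eventually_lt_const hc
    obtain ⟨k, hk1, hk2⟩ := (h1.and (eventually_ge_atTop (N + 1))).exists
    rw [norm_div, norm_pow, Complex.norm_real, Real.norm_of_nonneg hρ0.le,
      div_lt_iff₀ (by positivity)] at hk1
    exact absurd (hgrow k hk2) (not_le.2 hk1)
  -- the combination of `B` and `R` that does
  set q := (B (N + 1) - l₁ * B N) / (R (N + 1) - l₁ * R N) with hq
  set y : ℕ → ℂ := fun k => B k - q * R k with hy
  have hqv : q * (R (N + 1) - l₁ * R N) = B (N + 1) - l₁ * B N := div_mul_cancel₀ _ hvR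
  obtain ⟨c, hc, hgrow⟩ := grow y (fun k => by simp only [hy, hB, hR]; ring)
    (by simp only [hy]; linear_combination -hqv) (by
      intro hu
      have h1 : (l₁ - l₂) * (R (N + 1) * B N - R N * B (N + 1)) = 0 := by
        simp only [hy] at hu
        linear_combination (R (N + 1) - R N * l₁) * hu + (R (N + 1) - l₂ * R N) * hqv
      exact hcas N ((mul_eq_zero.1 h1).resolve_left hd))
  have hy0 : ∀ k ≥ N + 1, y k ≠ 0 := fun k hk h0 => by
    have := hgrow k hk
    rw [h0, norm_zero] at this
    exact absurd this (not_le.2 (by positivity))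
  have hRy : Tendsto (fun k => R k / y k) atTop (𝓝 0) := by
    have h1 : Tendsto (fun k => ‖R k / (ρ : ℂ) ^ k‖ / c) atTop (𝓝 0) := by
      simpa using hRρ.norm.div_const c
    refine squeeze_zero_norm' ?_ h1
    filter_upwards [eventually_ge_atTop (N + 1)] with k hk
    rw [norm_div, norm_div, norm_pow, Complex.norm_real, Real.norm_of_nonneg hρ0.le, div_div,
      mul_comm _ c]
    exact div_le_div_of_nonneg_left (norm_nonneg _) (by positivity) (hgrow k hk)
  have hBy : Tendsto (fun k => 1 + q * (R k / y k)) atTop (𝓝 1) := by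
    simpa using (hRy.const_mul q).const_add 1
  have hBy' : ∀ k ≥ N + 1, B k = y k * (1 + q * (R k / y k)) := fun k hk => by
    have := hy0 k hk
    rw [mul_add, mul_one, mul_left_comm, mul_div_cancel₀ _ this]
    simp only [hy]
    ring
  constructor
  · filter_upwards [eventually_ge_atTop (N + 1), hBy.eventually_ne one_ne_zero] with k hk h1
    rw [hBy' k hk]
    exact mul_ne_zero (hy0 k hk) h1
  · have h1 := hRy.div hBy one_ne_zero
    rw [zero_div] at h1
    refine h1.congr' ?_
    filter_upwards [eventually_ge_atTop (N + 1)] with k hk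
    rw [hBy' k hk, ← div_div]
    rfl

/-- Convergence of a continued fraction whose reduced partial numerators
`a (k + 1) / (b k * b (k + 1))` tend to `-l₁ * l₂`, where `l₁ + l₂ = 1` and `|l₂| < |l₁|`: its
value is `f` as soon as the remainders `f * B k - A k`, divided by `b 0 ⋯ b (k - 1)`, are
`o(ρ ^ k)` for some `ρ < |l₁|`. -/
theorem haltingContFract_hasValue_of_recessive {h f : ℂ} {a b : ℕ → ℂ} (ha : ∀ k, a k ≠ 0)
    (hb : ∀ k, b k ≠ 0) (hl : l₁ + l₂ = 1) (hlt : ‖l₂‖ < ‖l₁‖)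
    (hα : Tendsto (fun k => a (k + 1) / (b k * b (k + 1))) atTop (𝓝 (-(l₁ * l₂))))
    {ρ : ℝ} (hρ0 : 0 < ρ) (hρ : ρ < ‖l₁‖)
    (hR : Tendsto (fun k => (f * threeTerm a b 0 1 (k + 1) - threeTerm a b 1 h (k + 1)) /
      (∏ i ∈ Finset.range k, b i) / (ρ : ℂ) ^ k) atTop (𝓝 0)) :
    ContFractHasValue (haltingContFract h a b) f := by
  have hP : ∀ k, ∏ i ∈ Finset.range k, b i ≠ 0 := fun k =>
    Finset.prod_ne_zero_iff.2 fun i _ => hb i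
  have hrec : ∀ u v k, threeTerm a b u v (k + 2 + 1) / (∏ i ∈ Finset.range (k + 2), b i) =
      threeTerm a b u v (k + 1 + 1) / (∏ i ∈ Finset.range (k + 1), b i) +
      a (k + 1) / (b k * b (k + 1)) *
        (threeTerm a b u v (k + 1) / (∏ i ∈ Finset.range k, b i)) := by
    intro u v k
    have h1 := hP k
    have h2 := hb k
    have h3 := hb (k + 1)
    rw [Finset.prod_range_succ, Finset.prod_range_succ,
      show threeTerm a b u v (k + 2 + 1) = b (k + 1) * threeTerm a b u v (k + 1 + 1) +
        a (k + 1) * threeTerm a b u v (k + 1) from rfl]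
    field_simp
  have hmain := tendsto_div_of_recessive hl hlt hα hρ0 hρ
    (B := fun k => threeTerm a b 0 1 (k + 1) / (∏ i ∈ Finset.range k, b i))
    (R := fun k => (f * threeTerm a b 0 1 (k + 1) - threeTerm a b 1 h (k + 1)) /
      (∏ i ∈ Finset.range k, b i)) (fun k => hrec 0 1 k)
    (fun k => by
      have e1 := hrec 0 1 k
      have e2 := hrec 1 h k
      simp only [sub_div, mul_div_assoc]
      linear_combination f * e1 - e2) hR
    (fun k => by
      have hc := threeTerm_casoratian_ne_zero (h := h) (b := b) (k := k + 1) fun i _ => ha i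
      have h1 := hP k
      have h2 := hP (k + 1)
      rw [div_mul_div_comm, div_mul_div_comm,
        mul_comm (∏ i ∈ Finset.range k, b i), ← sub_div]
      refine div_ne_zero ?_ (mul_ne_zero h2 h1)
      intro h0
      apply hc
      linear_combination -h0)
  have hd : ∀ k, (haltingContFract h a b).dens k = threeTerm a b 0 1 (k + 1) := fun k =>
    haltingContFract_dens fun i _ => ha i
  have hn : ∀ k, (haltingContFract h a b).nums k = threeTerm a b 1 h (k + 1) := fun k =>
    haltingContFract_nums fun i _ => ha i
  have hne : ∀ᶠ k in atTop, threeTerm a b 0 1 (k + 1) ≠ 0 := by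
    filter_upwards [hmain.1] with k hk h0
    apply hk
    rw [h0, zero_div]
  constructor
  · filter_upwards [hne] with k hk
    rwa [hd]
  · have h1 := hmain.2.const_sub f
    rw [sub_zero] at h1
    refine h1.congr' ?_
    filter_upwards [hne] with k hk
    rw [GenContFract.conv_eq_num_div_den, hd, hn, div_div_div_cancel_right₀ (hP k)]
    field_simp
    ring

end Growth

/-! ### The saddle-point bound -/

section CoshEstimate

theorem Real.sinh_mul_le_mul_sinh {τ a : ℝ} (h0 : 0 ≤ τ) (h1 : τ ≤ 1) (ha : 0 ≤ a) :
    Real.sinh (τ * a) ≤ τ * Real.sinh a := by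
  have hconv : ConvexOn ℝ (Set.Ici 0) Real.sinh := by
    refine MonotoneOn.convexOn_of_deriv (convex_Ici 0) Real.continuous_sinh.continuousOn
      Real.differentiable_sinh.differentiableOn ?_
    rw [Real.deriv_sinh, interior_Ici]
    intro s hs t ht hst
    rw [Real.cosh_le_cosh, abs_of_pos hs, abs_of_pos ht]
    exact hst
  have := hconv.2 (x := 0) (by simp) (y := a) ha (sub_nonneg.2 h1) h0 (by ring)
  simpa using this

theorem Real.sinh_sq_le_cosh_mul_cos_add {τ a b : ℝ} (h0 : 0 ≤ τ) (h1 : τ ≤ 1) (ha : 0 ≤ a)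
    (hb : 0 ≤ b) (hb' : b < Real.pi / 2) :
    Real.sinh (τ * a) ^ 2 ≤
      Real.cosh a * Real.cos b * (Real.cosh (τ * a) * Real.cos (τ * b)) +
      Real.sinh a * Real.sin b * (Real.sinh (τ * a) * Real.sin (τ * b)) := by
  have hτb : 0 ≤ τ * b := mul_nonneg h0 hb
  have hτb' : τ * b ≤ b := by nlinarith
  have hc1 : 0 ≤ Real.cos b := Real.cos_nonneg_of_mem_Icc ⟨by linarith, hb'.le⟩
  have hc2 : 0 ≤ Real.cos (τ * b) := Real.cos_nonneg_of_mem_Icc ⟨by linarith, by linarith⟩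
  have hs1 : 0 ≤ Real.sinh a := Real.sinh_nonneg_iff.2 ha
  have hs2 : 0 ≤ Real.sinh (τ * a) := Real.sinh_nonneg_iff.2 (mul_nonneg h0 ha)
  have hcs : Real.sinh a * Real.sinh (τ * a) ≤ Real.cosh a * Real.cosh (τ * a) :=
    mul_le_mul (Real.sinh_lt_cosh a).le (Real.sinh_lt_cosh _).le hs2 (Real.cosh_pos a).le
  have hcos : τ ≤ Real.cos (b - τ * b) := by
    have h2 := Real.one_sub_mul_le_cos (x := b - τ * b) (by linarith) (by linarith)
    refine le_trans ?_ h2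
    have h3 : 2 / Real.pi * b ≤ 1 := by
      rw [div_mul_eq_mul_div, div_le_one Real.pi_pos]
      linarith
    nlinarith
  rw [Real.cos_sub] at hcos
  have hconv := Real.sinh_mul_le_mul_sinh h0 h1 ha
  calc Real.sinh (τ * a) ^ 2 ≤ Real.sinh a * Real.sinh (τ * a) * τ := by nlinarith
    _ ≤ Real.sinh a * Real.sinh (τ * a) *
        (Real.cos b * Real.cos (τ * b) + Real.sin b * Real.sin (τ * b)) := by gcongr
    _ ≤ _ := by nlinarith [mul_le_mul_of_nonneg_right hcs (mul_nonneg hc1 hc2)]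

/-- The value of `|cosh l - cosh (τ l)|` at the saddle point `τ = 0` and everywhere else on the
segment stays below `|1 + cosh l|`. -/
theorem Complex.norm_cosh_sub_cosh_lt {l : ℂ} (hl : |l.im| < Real.pi / 2) {τ : ℝ} (hτ : |τ| ≤ 1) :
    ‖Complex.cosh l - Complex.cosh (τ * l)‖ < ‖1 + Complex.cosh l‖ := by
  have hcosh : ∀ a b : ℝ, Complex.cosh (a + b * Complex.I) =
      (Real.cosh a * Real.cos b : ℝ) + (Real.sinh a * Real.sin b : ℝ) * Complex.I := by
    intro a b
    rw [Complex.cosh_add, Complex.cosh_mul_I, Complex.sinh_mul_I]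
    push_cast
    ring
  obtain ⟨a, b, rfl⟩ : ∃ a b : ℝ, l = a + b * Complex.I := ⟨l.re, l.im, (Complex.re_add_im l).symm⟩
  have him : (a + b * Complex.I : ℂ).im = b := by simp
  rw [him] at hl
  have hmul : (τ : ℂ) * (a + b * Complex.I) = ((τ * a : ℝ) : ℂ) + ((τ * b : ℝ) : ℂ) * Complex.I := by
    push_cast; ring
  have hcosb : 0 < Real.cos b := Real.cos_pos_of_mem_Ioo (abs_lt.1 hl)
  -- reduction to non-negative `τ`, `a` and `b`
  have hkey : Real.sinh (τ * a) ^ 2 ≤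
      Real.cosh a * Real.cos b * (Real.cosh (τ * a) * Real.cos (τ * b)) +
      Real.sinh a * Real.sin b * (Real.sinh (τ * a) * Real.sin (τ * b)) := by
    have h := Real.sinh_sq_le_cosh_mul_cos_add (abs_nonneg τ) hτ (abs_nonneg a) (abs_nonneg b) hl
    rcases abs_cases τ with ⟨e1, -⟩ | ⟨e1, -⟩ <;> rcases abs_cases a with ⟨e2, -⟩ | ⟨e2, -⟩ <;>
      rcases abs_cases b with ⟨e3, -⟩ | ⟨e3, -⟩ <;> rw [e1, e2, e3] at h <;>
      simpa using h
  rw [hmul, hcosh, hcosh, ← sq_lt_sq₀ (norm_nonneg _) (norm_nonneg _), Complex.sq_norm,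
    Complex.sq_norm, Complex.normSq_apply, Complex.normSq_apply]
  simp only [Complex.add_re, Complex.sub_re, Complex.add_im, Complex.sub_im, Complex.ofReal_re,
    Complex.ofReal_im, Complex.mul_re, Complex.mul_im, Complex.I_re, Complex.I_im, Complex.one_re,
    Complex.one_im]
  have hpos := mul_pos (Real.cosh_pos a) hcosb
  have hsq : (Real.cosh (τ * a) * Real.cos (τ * b)) ^ 2 +
      (Real.sinh (τ * a) * Real.sin (τ * b)) ^ 2 ≤ Real.sinh (τ * a) ^ 2 + 1 := by
    rw [mul_pow, mul_pow, Real.cosh_sq, Real.sin_sq]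
    nlinarith [Real.cos_sq_le_one (τ * b)]
  nlinarith [sq_nonneg (Real.sinh (τ * a))]

end CoshEstimate

section Bound

variable {x L : ℂ}

/-- On the path of `powerIntegral`, with `s = exp (L / 2)`, the factor `t (1 - t) / (1 + t x)`
equals `2 s (cosh (L / 2) - cosh (τ L / 2)) / x ^ 2` where `τ = 2 σ - 1`, and
`(1 + s) ^ 2 = 2 s (1 + cosh (L / 2))`. -/
theorem norm_powerIntegrand_base_lt (hx : x ≠ 0) (hL : Complex.exp L = 1 + x)
    (him : |L.im| < Real.pi) {σ : ℝ} (hσ : σ ∈ Set.Icc (0 : ℝ) 1) :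
    ‖(Complex.exp (σ * L) - 1) / x * (1 - (Complex.exp (σ * L) - 1) / x) *
      Complex.exp (-(σ * L))‖ * ‖x‖ ^ 2 < ‖1 + Complex.exp (L / 2)‖ ^ 2 := by
  have hl : |(L / 2).im| < Real.pi / 2 := by
    have : (L / 2).im = L.im / 2 := by simp
    rw [this, abs_div, abs_two]
    linarith
  have hτ : |2 * σ - 1| ≤ 1 := abs_le.2 ⟨by linarith [hσ.1], by linarith [hσ.2]⟩
  have h := Complex.norm_cosh_sub_cosh_lt hl hτ
  have hs : 0 < ‖2 * Complex.exp (L / 2)‖ := by simp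
  have h' := mul_lt_mul_of_pos_left h hs
  rw [← norm_mul, ← norm_mul] at h'
  rw [← norm_pow, ← norm_pow, ← norm_mul]
  set s := Complex.exp (L / 2) with hsdef
  have hs0 : s ≠ 0 := Complex.exp_ne_zero _
  have hs2 : s ^ 2 = 1 + x := by
    rw [← hL, hsdef, ← Complex.exp_nat_mul]
    congr 1
    push_cast
    ring
  set E := Complex.exp (σ * L) with hE
  have hE0 : E ≠ 0 := Complex.exp_ne_zero _
  have e1 : Complex.exp (((2 * σ - 1 : ℝ) : ℂ) * (L / 2)) = E / s := by
    rw [hE, hsdef, ← Complex.exp_sub]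
    congr 1
    push_cast
    ring
  have hcosh : ∀ w : ℂ, Complex.cosh w = (Complex.exp w + (Complex.exp w)⁻¹) / 2 := fun w => by
    rw [← Complex.exp_neg]; rfl
  have f1 : (E - 1) / x * (1 - (E - 1) / x) * Complex.exp (-(σ * L)) * x ^ 2 =
      2 * s * (Complex.cosh (L / 2) - Complex.cosh (((2 * σ - 1 : ℝ) : ℂ) * (L / 2))) := by
    rw [hcosh, hcosh, Complex.exp_neg, e1, ← hE, ← hsdef]
    have hxs : x = s ^ 2 - 1 := by rw [hs2]; ring
    field_simp
    rw [hxs]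
    ring
  have f2 : (1 + s) ^ 2 = 2 * s * (1 + Complex.cosh (L / 2)) := by
    rw [hcosh, ← hsdef]
    field_simp
    ring
  rw [f1, f2]
  exact h'

/-- Exponential bounds for the integrals of the tails, with a base `M` for which `M |x| ^ 2` is
below `|1 + s| ^ 2`, four times the squared modulus of the dominant root `(1 + s) / 2`. -/
theorem exists_powerIntegral_bound (hx : x ≠ 0) (hL : Complex.exp L = 1 + x)
    (him : |L.im| < Real.pi) (n : ℂ) :
    ∃ M C : ℝ, 0 < M ∧ M * ‖x‖ ^ 2 < ‖1 + Complex.exp (L / 2)‖ ^ 2 ∧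
      ∀ k : ℕ, ‖powerIntegral x L k k (n - k)‖ ≤ C * M ^ k ∧
        ‖powerIntegral x L k (k + 1) (n - 1 - k)‖ ≤ C * M ^ k := by
  set G : ℝ → ℂ := fun σ => (Complex.exp (σ * L) - 1) / x * (1 - (Complex.exp (σ * L) - 1) / x) *
    Complex.exp (-(σ * L)) with hG
  have hGc : Continuous G := by fun_prop
  obtain ⟨σ₀, hσ₀, hmax⟩ := isCompact_Icc.exists_isMaxOn (Set.nonempty_Icc.2 zero_le_one)
    (hGc.norm.continuousOn (s := Set.Icc (0 : ℝ) 1))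
  have hx2 : 0 < ‖x‖ ^ 2 := by positivity
  have hlt := norm_powerIntegrand_base_lt hx hL him hσ₀
  rw [← lt_div_iff₀ hx2] at hlt
  obtain ⟨M, hM1, hM2⟩ := exists_between hlt
  have hGM : ∀ σ ∈ Set.Icc (0 : ℝ) 1, ‖G σ‖ ≤ M := fun σ hσ =>
    (isMaxOn_iff.1 hmax σ hσ).trans hM1.le
  have hc1 : Continuous fun σ : ℝ => Complex.exp (n * (σ * L)) * (L / x) := by fun_prop
  have hc2 : Continuous fun σ : ℝ => (1 - (Complex.exp (σ * L) - 1) / x) *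
      Complex.exp ((n - 1) * (σ * L)) * (L / x) := by fun_prop
  obtain ⟨C1, hC1⟩ := isCompact_Icc.exists_bound_of_continuousOn
    (hc1.continuousOn (s := Set.Icc (0 : ℝ) 1))
  obtain ⟨C2, hC2⟩ := isCompact_Icc.exists_bound_of_continuousOn
    (hc2.continuousOn (s := Set.Icc (0 : ℝ) 1))
  have hM0 : 0 < M := (norm_nonneg _).trans_lt hM1
  refine ⟨M, max C1 C2, hM0, (lt_div_iff₀ hx2).1 hM2, fun k => ⟨?_, ?_⟩⟩
  · have := intervalIntegral.norm_integral_le_of_norm_le_const (a := 0) (b := 1)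
      (f := fun σ : ℝ => ((Complex.exp (σ * L) - 1) / x) ^ k *
        (1 - (Complex.exp (σ * L) - 1) / x) ^ k * Complex.exp ((n - k) * (σ * L)) * (L / x))
      (C := max C1 C2 * M ^ k) (fun σ hσ => by
        rw [Set.uIoc_of_le zero_le_one] at hσ
        have hσ' := Set.Ioc_subset_Icc_self hσ
        have e : ((Complex.exp (σ * L) - 1) / x) ^ k *
            (1 - (Complex.exp (σ * L) - 1) / x) ^ k * Complex.exp ((n - k) * (σ * L)) * (L / x) =
            (Complex.exp (n * (σ * L)) * (L / x)) * G σ ^ k := by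
          rw [hG, mul_pow, mul_pow, ← Complex.exp_nat_mul,
            show (n - k) * (σ * L) = n * (σ * L) + k * (-(σ * L)) by ring, Complex.exp_add]
          ring
        rw [e, norm_mul, norm_pow]
        exact mul_le_mul ((hC1 σ hσ').trans (le_max_left _ _))
          (pow_le_pow_left₀ (norm_nonneg _) (hGM σ hσ') k) (by positivity)
          (((norm_nonneg _).trans (hC1 σ hσ')).trans (le_max_left _ _)))
    simpa [powerIntegral] using this
  · have := intervalIntegral.norm_integral_le_of_norm_le_const (a := 0) (b := 1)
      (f := fun σ : ℝ => ((Complex.exp (σ * L) - 1) / x) ^ k *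
        (1 - (Complex.exp (σ * L) - 1) / x) ^ (k + 1) * Complex.exp ((n - 1 - k) * (σ * L)) *
          (L / x))
      (C := max C1 C2 * M ^ k) (fun σ hσ => by
        rw [Set.uIoc_of_le zero_le_one] at hσ
        have hσ' := Set.Ioc_subset_Icc_self hσ
        have e : ((Complex.exp (σ * L) - 1) / x) ^ k *
            (1 - (Complex.exp (σ * L) - 1) / x) ^ (k + 1) *
              Complex.exp ((n - 1 - k) * (σ * L)) * (L / x) =
            ((1 - (Complex.exp (σ * L) - 1) / x) *
              Complex.exp ((n - 1) * (σ * L)) * (L / x)) * G σ ^ k := by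
          rw [hG, mul_pow, mul_pow, ← Complex.exp_nat_mul,
            show (n - 1 - k) * (σ * L) = (n - 1) * (σ * L) + k * (-(σ * L)) by ring,
            Complex.exp_add]
          ring
        rw [e, norm_mul, norm_pow]
        exact mul_le_mul ((hC2 σ hσ').trans (le_max_right _ _))
          (pow_le_pow_left₀ (norm_nonneg _) (hGM σ hσ') k) (by positivity)
          (((norm_nonneg _).trans (hC2 σ hσ')).trans (le_max_right _ _)))
    simpa [powerIntegral] using this

end Bound

theorem tendsto_of_even_odd {α : Type*} {l : Filter α} {f : ℕ → α}
    (h0 : Tendsto (fun k => f (2 * k)) atTop l) (h1 : Tendsto (fun k => f (2 * k + 1)) atTop l) :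
    Tendsto f atTop l := by
  intro s hs
  obtain ⟨N0, hN0⟩ := eventually_atTop.1 (h0 hs)
  obtain ⟨N1, hN1⟩ := eventually_atTop.1 (h1 hs)
  refine eventually_atTop.2 ⟨2 * max N0 N1 + 1, fun k hk => ?_⟩
  obtain ⟨j, rfl | rfl⟩ := Nat.even_or_odd' k
  · exact hN0 j (by omega)
  · exact hN1 j (by omega)

/-! ### Convergence of Lagrange's continued fraction -/

section LagrangeConvergence

theorem lagrangeDen_ne_zero (k : ℕ) : lagrangeDen k ≠ 0 := by
  unfold lagrangeDen
  split_ifs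
  · exact_mod_cast k.succ_ne_zero
  · exact two_ne_zero

theorem tendsto_lagrange_reduced (n x : ℂ) :
    Tendsto (fun k => lagrangeNum n x (k + 1) / (lagrangeDen k * lagrangeDen (k + 1))) atTop
      (𝓝 (x / 4)) := by
  refine tendsto_of_even_odd ?_ ?_
  · have h := (tendsto_add_mul_div_add_mul_atTop_nhds (1 - n) 1 1
      (two_ne_zero (α := ℂ))).mul_const (x / 2)
    convert h using 2 with k
    · rw [lagrangeNum_odd, lagrangeDen_even, lagrangeDen_odd]
      have : (2 * k + 1 : ℂ) ≠ 0 := by exact_mod_cast (2 * k).succ_ne_zero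
      have h' : (1 + 2 * k : ℂ) ≠ 0 := by rwa [add_comm]
      field_simp
      ring
    · ring
  · have h := (tendsto_add_mul_div_add_mul_atTop_nhds (1 + n) 3 1
      (two_ne_zero (α := ℂ))).mul_const (x / 2)
    convert h using 2 with k
    · rw [show 2 * k + 1 + 1 = 2 * (k + 1) by ring, lagrangeNum_even, lagrangeDen_even,
        lagrangeDen_odd]
      have : (2 * (k + 1) + 1 : ℂ) ≠ 0 := by exact_mod_cast (2 * (k + 1)).succ_ne_zero
      have h' : (3 + 2 * k : ℂ) ≠ 0 := by
        rw [show (3 + 2 * k : ℂ) = 2 * (k + 1) + 1 by ring]; exact this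
      push_cast
      field_simp
      ring
    · ring

/-- The remainders of Lagrange's continued fraction are of smaller order than the dominant
solutions of its recurrence. -/
theorem tendsto_lagrange_remainder {n x L : ℂ} (hx : x ≠ 0) (hL : Complex.exp L = 1 + x)
    (him : |L.im| < Real.pi) (ha : ∀ k, lagrangeNum n x k ≠ 0) :
    ∃ ρ : ℝ, 0 < ρ ∧ ρ < ‖(1 + Complex.exp (L / 2)) / 2‖ ∧
      Tendsto (fun k => (Complex.exp (n * L) * threeTerm (lagrangeNum n x) lagrangeDen 0 1 (k + 1) -
        threeTerm (lagrangeNum n x) lagrangeDen 1 1 (k + 1)) /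
        (∏ i ∈ Finset.range k, lagrangeDen i) / (ρ : ℂ) ^ k) atTop (𝓝 0) := by
  obtain ⟨M, C, hM0, hM, hbound⟩ := exists_powerIntegral_bound hx hL him n
  set lam := ‖(1 + Complex.exp (L / 2)) / 2‖ with hlam
  have hlam2 : M * ‖x‖ ^ 2 / 4 < lam ^ 2 := by
    rw [hlam, norm_div, div_pow, Complex.norm_two]
    norm_num
    linarith
  -- `ρ ^ 2` separates the growth rates, over two steps, of the remainders and of dominant solutions
  obtain ⟨r, hr1, hr2⟩ := exists_between hlam2
  have hr0 : 0 < r := lt_of_le_of_lt (by positivity) hr1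
  set ρ := Real.sqrt r with hρ
  have hρ0 : 0 < ρ := Real.sqrt_pos.2 hr0
  have hρ2 : ρ ^ 2 = r := Real.sq_sqrt hr0.le
  refine ⟨ρ, hρ0, ?_, ?_⟩
  · refine lt_of_pow_lt_pow_left₀ 2 (norm_nonneg _) ?_
    rw [hρ2]
    exact hr2
  have hP : ∀ k, ∏ i ∈ Finset.range k, lagrangeDen i ≠ 0 := fun k =>
    Finset.prod_ne_zero_iff.2 fun i _ => lagrangeDen_ne_zero i
  have hA : ∀ k, ∏ i ∈ Finset.range k, -lagrangeNum n x i ≠ 0 := fun k =>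
    Finset.prod_ne_zero_iff.2 fun i _ => neg_ne_zero.2 (ha i)
  set V : ℕ → ℂ := fun k => (∏ i ∈ Finset.range (2 * k + 1), -lagrangeNum n x i) /
    (∏ i ∈ Finset.range (2 * k), lagrangeDen i) / k.factorial * (M : ℂ) ^ k / (ρ : ℂ) ^ (2 * k)
    with hV
  have hMc : (M : ℂ) ≠ 0 := by exact_mod_cast hM0.ne'
  have hρc : (ρ : ℂ) ≠ 0 := by exact_mod_cast hρ0.ne'
  have hV0 : ∀ k, V k ≠ 0 := by
    intro k
    have hf : (k.factorial : ℂ) ≠ 0 := by exact_mod_cast k.factorial_ne_zero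
    exact div_ne_zero (mul_ne_zero (div_ne_zero (div_ne_zero (hA _) (hP _)) hf)
      (pow_ne_zero _ hMc)) (pow_ne_zero _ hρc)
  have hVlim : Tendsto V atTop (𝓝 0) := by
    have hratio : Tendsto (fun k => V (k + 1) / V k) atTop
        (𝓝 (1 / 2 * (1 / 1) * (x ^ 2 * M / (2 * ρ ^ 2)))) := by
      have h := ((tendsto_add_mul_div_add_mul_atTop_nhds (1 - n) 1 1
        (two_ne_zero (α := ℂ))).mul (tendsto_add_mul_div_add_mul_atTop_nhds (1 + n) 1 1
        (one_ne_zero (α := ℂ)))).mul_const (x ^ 2 * M / (2 * ρ ^ 2))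
      refine h.congr fun k => ?_
      have h1 := hA (2 * k + 1)
      have h2 := hP (2 * k)
      have h3 : (1 + 2 * k : ℂ) ≠ 0 := by rw [add_comm]; exact_mod_cast (2 * k).succ_ne_zero
      have h4 : (1 + k : ℂ) ≠ 0 := by rw [add_comm]; exact_mod_cast k.succ_ne_zero
      have hf : (k.factorial : ℂ) ≠ 0 := by exact_mod_cast k.factorial_ne_zero
      simp only [hV]
      rw [show 2 * (k + 1) + 1 = 2 * k + 1 + 1 + 1 by ring, show 2 * (k + 1) = 2 * k + 1 + 1 by ring,
        Finset.prod_range_succ _ (2 * k + 1 + 1),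
        Finset.prod_range_succ (fun i => -lagrangeNum n x i) (2 * k + 1),
        Finset.prod_range_succ _ (2 * k + 1), Finset.prod_range_succ lagrangeDen (2 * k),
        Nat.factorial_succ, show 2 * k + 1 + 1 = 2 * (k + 1) by ring, lagrangeNum_even,
        lagrangeNum_odd, lagrangeDen_even, lagrangeDen_odd,
        show 2 * (k + 1) = 2 * k + 1 + 1 by ring, pow_succ, pow_succ, pow_succ]
      push_cast
      rw [show (k + 1 : ℂ) = 1 + k by ring, show (2 * k + 1 : ℂ) = 1 + 2 * k by ring]
      generalize ∏ i ∈ Finset.range (2 * k + 1), -lagrangeNum n x i = A at *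
      generalize ∏ i ∈ Finset.range (2 * k), lagrangeDen i = B at *
      field_simp
      ring
    have hn := hratio.norm
    refine (summable_of_ratio_test_tendsto_lt_one (l := ‖(1 / 2 * (1 / 1) *
      (x ^ 2 * M / (2 * ρ ^ 2)) : ℂ)‖) ?_ (Eventually.of_forall hV0) ?_).tendsto_atTop_zero
    · have e : (1 / 2 * (1 / 1) * (x ^ 2 * M / (2 * ρ ^ 2)) : ℂ) =
          x ^ 2 * ((M / (4 * r) : ℝ) : ℂ) := by
        rw [← hρ2]; push_cast; ring
      rw [e, norm_mul, norm_pow, Complex.norm_real, Real.norm_of_nonneg (by positivity),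
        ← mul_div_assoc, div_lt_one (by positivity)]
      linarith
    · simpa only [norm_div] using hn
  have hrem := fun k => threeTerm_remainder (f := Complex.exp (n * L)) (J := lagrangeTail n x L) rfl
    (exp_eq_lagrangeTail hx n) (lagrangeTail_recurrence hx hL n) (k + 1)
  simp only [hrem]
  refine tendsto_of_even_odd ?_ ?_
  · have h0 : Tendsto (fun k => C * ‖V k‖) atTop (𝓝 0) := by simpa using hVlim.norm.const_mul C
    refine squeeze_zero_norm (fun k => ?_) h0
    rw [lagrangeTail_odd]
    have e : -(∏ i ∈ Finset.range (2 * k + 1), -lagrangeNum n x i) *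
        (powerIntegral x L k k (n - k) / k.factorial) / (∏ i ∈ Finset.range (2 * k), lagrangeDen i) /
        (ρ : ℂ) ^ (2 * k) = -(V k * (powerIntegral x L k k (n - k) / (M : ℂ) ^ k)) := by
      simp only [hV]
      field_simp
    rw [e, norm_neg, norm_mul, mul_comm C]
    refine mul_le_mul_of_nonneg_left ?_ (norm_nonneg _)
    rw [norm_div, norm_pow, Complex.norm_real, Real.norm_of_nonneg hM0.le,
      div_le_iff₀ (by positivity)]
    exact (hbound k).1
  · have hw := (tendsto_add_mul_div_add_mul_atTop_nhds (1 - n) 1 1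
      (two_ne_zero (α := ℂ))).mul_const (x / ρ)
    have h0 := ((hVlim.mul hw).norm).const_mul C
    rw [zero_mul, norm_zero, mul_zero] at h0
    refine squeeze_zero_norm (fun k => ?_) h0
    rw [show 2 * k + 1 + 1 = 2 * k + 2 by ring, lagrangeTail_even, Finset.prod_range_succ,
      Finset.prod_range_succ lagrangeDen (2 * k), lagrangeNum_odd, lagrangeDen_even]
    have h3 : (2 * k + 1 : ℂ) ≠ 0 := by exact_mod_cast (2 * k).succ_ne_zero
    have e : -((∏ i ∈ Finset.range (2 * k + 1), -lagrangeNum n x i) * -((k + 1 - n) * x)) *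
        (powerIntegral x L k (k + 1) (n - 1 - k) / k.factorial) /
        ((∏ i ∈ Finset.range (2 * k), lagrangeDen i) * (2 * k + 1)) / (ρ : ℂ) ^ (2 * k + 1) =
        (V k * ((1 - n + 1 * k) / (1 + 2 * k) * (x / ρ))) *
          (powerIntegral x L k (k + 1) (n - 1 - k) / (M : ℂ) ^ k) := by
      simp only [hV]
      have h4 : (1 + 2 * k : ℂ) ≠ 0 := by rwa [add_comm]
      rw [show (2 * k + 1 : ℂ) = 1 + 2 * k by ring, pow_succ (ρ : ℂ)]
      have h2 := hP (2 * k)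
      generalize ∏ i ∈ Finset.range (2 * k + 1), -lagrangeNum n x i = A at *
      generalize ∏ i ∈ Finset.range (2 * k), lagrangeDen i = B at *
      field_simp
      ring
    rw [e, norm_mul, mul_comm C]
    refine mul_le_mul_of_nonneg_left ?_ (norm_nonneg _)
    rw [norm_div, norm_pow, Complex.norm_real, Real.norm_of_nonneg hM0.le,
      div_le_iff₀ (by positivity)]
    exact (hbound k).2

/-- Lagrange's expansion. If some partial numerator vanishes, the value is exact; otherwise the
characteristic roots of the limiting recurrence are `(1 ± s) / 2` with `s = exp (log (1 + x) / 2)`,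
and `Re s > 0` makes the first one dominant. -/
theorem lagrangeContFract_hasValue (n x : ℂ) (hx : 1 + x ∈ Complex.slitPlane) :
    ContFractHasValue (lagrangeContFract n x) ((1 + x) ^ n) := by
  have h1x : 1 + x ≠ 0 := Complex.slitPlane_ne_zero hx
  set L := Complex.log (1 + x) with hLdef
  have hL : Complex.exp L = 1 + x := Complex.exp_log h1x
  have hpow : (1 + x) ^ n = Complex.exp (n * L) := by
    rw [Complex.cpow_def_of_ne_zero h1x, mul_comm]
  have him : |L.im| < Real.pi := by
    rw [hLdef, Complex.log_im, abs_lt]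
    exact ⟨Complex.neg_pi_lt_arg _, lt_of_le_of_ne (Complex.arg_le_pi _)
      (Complex.slitPlane_arg_ne_pi hx)⟩
  rw [lagrangeContFract_eq]
  rcases eq_or_ne x 0 with rfl | hx0
  · have h0 : lagrangeNum n 0 0 = 0 := by simp [lagrangeNum]
    have ht := haltingContFract_terminatedAt (h := 1) (b := lagrangeDen) h0 le_rfl
    refine contFractHasValue_of_terminatedAt ht ?_ ?_
    · rw [GenContFract.zeroth_den_eq_one]
      exact one_ne_zero
    · rw [GenContFract.zeroth_den_eq_one, GenContFract.zeroth_num_eq_h]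
      simp [haltingContFract]
  rw [hpow]
  by_cases hz : ∃ k, lagrangeNum n x k = 0
  · classical
    obtain ⟨hB, hA⟩ := haltingContFract_value_of_eq_zero (h := 1) (J := lagrangeTail n x L) rfl
      (exp_eq_lagrangeTail hx0 n) (lagrangeTail_recurrence hx0 hL n) (Nat.find_spec hz)
      fun i hi => Nat.find_min hz hi
    exact contFractHasValue_of_terminatedAt
      (haltingContFract_terminatedAt (Nat.find_spec hz) le_rfl) hB hA
  · push Not at hz
    obtain ⟨ρ, hρ0, hρ, hlim⟩ := tendsto_lagrange_remainder hx0 hL him hz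
    set s := Complex.exp (L / 2) with hs
    have hs2 : s ^ 2 = 1 + x := by
      rw [← hL, hs, ← Complex.exp_nat_mul]
      congr 1
      push_cast
      ring
    have hre : 0 < s.re := by
      rw [hs, Complex.exp_re]
      have : (L / 2).im = L.im / 2 := by simp
      rw [this]
      rw [abs_lt] at him
      exact mul_pos (Real.exp_pos _) (Real.cos_pos_of_mem_Ioo
        ⟨by linarith [him.1], by linarith [him.2]⟩)
    refine haltingContFract_hasValue_of_recessive (l₁ := (1 + s) / 2) (l₂ := (1 - s) / 2) hz
      lagrangeDen_ne_zero (by ring) ?_ ?_ hρ0 hρ hlim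
    · rw [norm_div, norm_div]
      refine div_lt_div_of_pos_right ?_ (by simp)
      rw [← sq_lt_sq₀ (norm_nonneg _) (norm_nonneg _), Complex.sq_norm, Complex.sq_norm,
        Complex.normSq_apply, Complex.normSq_apply]
      simp only [Complex.add_re, Complex.sub_re, Complex.add_im, Complex.sub_im, Complex.one_re,
        Complex.one_im]
      nlinarith
    · have h4 : -((1 + s) / 2 * ((1 - s) / 2)) = x / 4 := by linear_combination hs2 / 4
      rw [h4]
      exact tendsto_lagrange_reduced n x

end LagrangeConvergence

/-! ### Convergence and termination of Euler's continued fraction -/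

section EulerConvergence

/-- The two logarithms have imaginary parts of opposite sign, whose difference is less than `π` in
absolute value since `(1 + z) / (1 - z)` lies in the same half-plane as `z`. -/
theorem abs_im_log_sub_log_lt {z : ℂ} (h1 : 1 + z ∈ Complex.slitPlane)
    (h2 : 1 - z ∈ Complex.slitPlane) :
    |(Complex.log (1 + z) - Complex.log (1 - z)).im| < Real.pi := by
  -- by the symmetry `z ↦ -z` only the upper half-plane has to be considered
  have key : ∀ z : ℂ, 1 + z ≠ 0 → 1 - z ≠ 0 → 0 < z.im →
      |(Complex.log (1 + z) - Complex.log (1 - z)).im| < Real.pi := by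
    intro z h1 h2 hz
    have hsin : 0 < Real.sin (Complex.log (1 + z) - Complex.log (1 - z)).im := by
      have him : 0 < (Complex.exp (Complex.log (1 + z) - Complex.log (1 - z))).im := by
        rw [Complex.exp_sub, Complex.exp_log h1, Complex.exp_log h2, Complex.div_im]
        have hN : 0 < Complex.normSq (1 - z) := Complex.normSq_pos.2 h2
        rw [div_sub_div_same]
        refine div_pos ?_ hN
        simp
        nlinarith
      rw [Complex.exp_im] at him
      exact (pos_iff_pos_of_mul_pos him).1 (Real.exp_pos _)
    have ha : 0 < (1 + z).arg := lt_of_le_of_ne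
      (Complex.arg_nonneg_iff.2 (by simpa using hz.le)) (fun h => by
        have := (Complex.arg_eq_zero_iff.1 h.symm).2
        simp at this
        exact hz.ne' this)
    have hb : (1 - z).arg < 0 := Complex.arg_neg_iff.2 (by simpa using hz)
    have ha' := Complex.arg_le_pi (1 + z)
    have hb' := Complex.neg_pi_lt_arg (1 - z)
    rw [Complex.sub_im, Complex.log_im, Complex.log_im] at hsin ⊢
    rw [abs_of_pos (by linarith)]
    by_contra hge
    push Not at hge
    have h3 := Real.sin_nonneg_of_nonneg_of_le_pi
      (x := (1 + z).arg - (1 - z).arg - Real.pi) (by linarith) (by linarith)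
    rw [Real.sin_sub_pi] at h3
    linarith
  have hz1 := Complex.slitPlane_ne_zero h1
  have hz2 := Complex.slitPlane_ne_zero h2
  rcases lt_trichotomy z.im 0 with h | h | h
  · have := key (-z) (by rwa [← sub_eq_add_neg]) (by rwa [sub_neg_eq_add]) (by simpa using h)
    rwa [← sub_eq_add_neg, sub_neg_eq_add, ← abs_neg, ← Complex.neg_im, neg_sub] at this
  · rw [Complex.mem_slitPlane_iff] at h1 h2
    have e1 : (1 + z).arg = 0 := Complex.arg_eq_zero_iff.2
      ⟨(h1.resolve_right (by simp [h])).le, by simp [h]⟩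
    have e2 : (1 - z).arg = 0 := Complex.arg_eq_zero_iff.2
      ⟨(h2.resolve_right (by simp [h])).le, by simp [h]⟩
    rw [Complex.sub_im, Complex.log_im, Complex.log_im, e1, e2]
    simpa using Real.pi_pos
  · exact key z hz1 hz2 h

theorem div_mem_slitPlane_and_cpow {z : ℂ} (h1 : 1 + z ∈ Complex.slitPlane)
    (h2 : 1 - z ∈ Complex.slitPlane) (n : ℂ) :
    (1 + z) / (1 - z) ∈ Complex.slitPlane ∧
      ((1 + z) / (1 - z)) ^ n = (1 + z) ^ n / (1 - z) ^ n := by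
  have hz1 := Complex.slitPlane_ne_zero h1
  have hz2 := Complex.slitPlane_ne_zero h2
  have him := abs_lt.1 (abs_im_log_sub_log_lt h1 h2)
  have hexp : Complex.exp (Complex.log (1 + z) - Complex.log (1 - z)) = (1 + z) / (1 - z) := by
    rw [Complex.exp_sub, Complex.exp_log hz1, Complex.exp_log hz2]
  have hlog : Complex.log ((1 + z) / (1 - z)) = Complex.log (1 + z) - Complex.log (1 - z) := by
    rw [← hexp, Complex.log_exp him.1 him.2.le]
  have hne : (1 + z) / (1 - z) ≠ 0 := div_ne_zero hz1 hz2
  constructor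
  · rw [Complex.mem_slitPlane_iff_arg]
    refine ⟨?_, hne⟩
    rw [← Complex.log_im, hlog]
    exact him.2.ne
  · rw [Complex.cpow_def_of_ne_zero hne, Complex.cpow_def_of_ne_zero hz1,
      Complex.cpow_def_of_ne_zero hz2, hlog, ← Complex.exp_sub, sub_mul]

/-- Reading off the contraction: the denominator of the Euler convergent vanishes exactly if the
Lagrange convergent is `1`. -/
theorem eulerContFract_convs_eq {n z x : ℂ} (hn : n ≠ 0) (hz : z ≠ 0) (hz1 : z ≠ 1)
    (hx : x * (1 - z) = 2 * z) (k : ℕ) (hL : (lagrangeContFract n x).dens (2 * k + 2) ≠ 0) :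
    ((eulerContFract n z).dens k ≠ 0 ↔ (lagrangeContFract n x).convs (2 * k + 2) ≠ 1) ∧
    ((lagrangeContFract n x).convs (2 * k + 2) ≠ 1 →
      n * z * ((lagrangeContFract n x).convs (2 * k + 2) + 1) /
        ((lagrangeContFract n x).convs (2 * k + 2) - 1) = (eulerContFract n z).convs k) := by
  obtain ⟨c, hc, e1, e2⟩ := exists_euler_eq_lagrange hn hz hz1 hx k
  rw [GenContFract.conv_eq_num_div_den, GenContFract.conv_eq_num_div_den]
  generalize GenContFract.nums (lagrangeContFract n x) (2 * k + 2) = A at *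
  generalize GenContFract.dens (lagrangeContFract n x) (2 * k + 2) = B at *
  generalize GenContFract.nums (eulerContFract n z) k = P at *
  generalize GenContFract.dens (eulerContFract n z) k = Q at *
  have hiff : Q ≠ 0 ↔ A / B ≠ 1 := by
    rw [not_iff_not, div_eq_one_iff_eq hL, ← sub_eq_zero (a := A), ← e2, mul_eq_zero]
    exact (or_iff_right hc).symm
  refine ⟨hiff, fun h1 => ?_⟩
  rw [div_eq_div_iff (sub_ne_zero.2 h1) (hiff.2 h1)]
  field_simp
  refine mul_left_cancel₀ hc ?_
  linear_combination n * z * (A + B) * e2 - (A - B) * e1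

theorem eulerContFract_hasValue {n z : ℂ} (h1 : 1 + z ∈ Complex.slitPlane)
    (h2 : 1 - z ∈ Complex.slitPlane) (hne : (1 + z) ^ n ≠ (1 - z) ^ n) :
    ContFractHasValue (eulerContFract n z) (eulerLeftMember n z) := by
  have hn : n ≠ 0 := by
    rintro rfl
    simp at hne
  have hz : z ≠ 0 := by
    rintro rfl
    simp at hne
  have hz2 := Complex.slitPlane_ne_zero h2
  have hz1 : z ≠ 1 := fun h => hz2 (by rw [h, sub_self])
  set x := 2 * (z / (1 - z)) with hx
  have hx' : x * (1 - z) = 2 * z := by rw [hx]; field_simp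
  have h1x : 1 + x = (1 + z) / (1 - z) := by rw [hx]; field_simp; ring
  obtain ⟨hslit, hpow⟩ := div_mem_slitPlane_and_cpow h1 h2 n
  rw [← h1x] at hslit hpow
  obtain ⟨hden, hlim⟩ := lagrangeContFract_hasValue n x hslit
  set w := (1 + x) ^ n with hw
  have hq : (1 - z) ^ n ≠ 0 := by
    rw [Complex.cpow_def_of_ne_zero hz2]
    exact Complex.exp_ne_zero _
  have hw1 : w ≠ 1 := by
    intro h
    rw [h, eq_comm, div_eq_one_iff_eq hq] at hpow
    exact hne hpow
  have hsub : Tendsto (fun k : ℕ => 2 * k + 2) atTop atTop :=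
    tendsto_atTop_mono (fun k => (by omega : k ≤ 2 * k + 2)) tendsto_id
  have hlim' : Tendsto (fun k => (lagrangeContFract n x).convs (2 * k + 2)) atTop (𝓝 w) :=
    hlim.comp hsub
  have hboth : ∀ᶠ k in atTop, (eulerContFract n z).dens k ≠ 0 ∧
      n * z * ((lagrangeContFract n x).convs (2 * k + 2) + 1) /
        ((lagrangeContFract n x).convs (2 * k + 2) - 1) = (eulerContFract n z).convs k := by
    filter_upwards [hsub.eventually hden, hlim'.eventually_ne hw1] with k hk1 hk2
    obtain ⟨h3, h4⟩ := eulerContFract_convs_eq hn hz hz1 hx' k hk1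
    exact ⟨h3.2 hk2, h4 hk2⟩
  refine ⟨hboth.mono fun k h => h.1, ?_⟩
  have hval : eulerLeftMember n z = n * z * (w + 1) / (w - 1) := by
    have hd : (1 + z) ^ n - (1 - z) ^ n ≠ 0 := sub_ne_zero.2 hne
    have hw1' : w - 1 ≠ 0 := sub_ne_zero.2 hw1
    rw [eulerLeftMember, div_eq_div_iff hd hw1', hpow]
    field_simp
  rw [hval]
  refine Tendsto.congr' (hboth.mono fun k h => h.2) ?_
  exact ((hlim'.add_const 1).const_mul (n * z)).div (hlim'.sub_const 1) (sub_ne_zero.2 hw1)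

end EulerConvergence

section Termination

theorem eulerLeftMember_neg {n z : ℂ} (h1 : z ≠ 1) (h2 : z ≠ -1) (h : (1 + z) ^ n ≠ (1 - z) ^ n) :
    (1 + z) ^ (-n) ≠ (1 - z) ^ (-n) ∧ eulerLeftMember (-n) z = eulerLeftMember n z := by
  have hp : 1 + z ≠ 0 := fun h0 => h2 (by linear_combination h0)
  have hm : 1 - z ≠ 0 := sub_ne_zero.2 h1.symm
  have hp' : (1 + z) ^ n ≠ 0 := by
    rw [Complex.cpow_def_of_ne_zero hp]; exact Complex.exp_ne_zero _
  have hm' : (1 - z) ^ n ≠ 0 := by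
    rw [Complex.cpow_def_of_ne_zero hm]; exact Complex.exp_ne_zero _
  refine ⟨?_, ?_⟩
  · rw [Complex.cpow_neg, Complex.cpow_neg]
    exact fun h0 => h (inv_injective h0)
  · rw [eulerLeftMember, eulerLeftMember, Complex.cpow_neg, Complex.cpow_neg]
    generalize (1 + z) ^ n = p at *
    generalize (1 - z) ^ n = q at *
    have h3 : p - q ≠ 0 := sub_ne_zero.2 h
    have h4 : p⁻¹ - q⁻¹ ≠ 0 := sub_ne_zero.2 fun h0 => h (inv_injective h0)
    have h5 : q - p ≠ 0 := sub_ne_zero.2 h.symm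
    rw [div_eq_div_iff h4 h3]
    field_simp
    ring

theorem continuous_threeTerm_euler (n u v : ℂ) (k : ℕ) :
    Continuous fun z => threeTerm (eulerNum n z) eulerDen u v k := by
  induction k using Nat.strong_induction_on with
  | _ k ih =>
    match k with
    | 0 => exact continuous_const
    | 1 => exact continuous_const
    | k + 2 =>
      have h1 := ih k (by omega)
      have h2 := ih (k + 1) (by omega)
      simp only [threeTerm, eulerNum]
      fun_prop

/-- The last convergent of the terminating continued fraction, cross-multiplied. For `z ≠ ±1` it
comes from the vanishing of the remainders in Lagrange's recurrence from index `2 m - 1` on, since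
the partial numerator `(m - n) x` is zero for `n = m`; the exceptional points follow by
continuity. -/
theorem threeTerm_euler_termination {m : ℕ} (hm : 1 ≤ m) (z : ℂ) :
    threeTerm (eulerNum m z) eulerDen 1 1 m * ((1 + z) ^ m - (1 - z) ^ m) =
      m * z * ((1 + z) ^ m + (1 - z) ^ m) * threeTerm (eulerNum m z) eulerDen 0 1 m := by
  have hm0 : (m : ℂ) ≠ 0 := by exact_mod_cast (by omega : m ≠ 0)
  have hgen : ∀ z ∈ ({0, 1, -1} : Set ℂ)ᶜ,
      threeTerm (eulerNum m z) eulerDen 1 1 m * ((1 + z) ^ m - (1 - z) ^ m) =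
      m * z * ((1 + z) ^ m + (1 - z) ^ m) * threeTerm (eulerNum m z) eulerDen 0 1 m := by
    intro z hz
    simp only [Set.mem_compl_iff, Set.mem_insert_iff, Set.mem_singleton_iff, not_or] at hz
    obtain ⟨hz0, hz1, hz2⟩ := hz
    have hp : 1 + z ≠ 0 := fun h0 => hz2 (by linear_combination h0)
    have hq : 1 - z ≠ 0 := sub_ne_zero.2 (Ne.symm hz1)
    set x := 2 * (z / (1 - z)) with hx
    have hx' : x * (1 - z) = 2 * z := by rw [hx]; field_simp
    have h1x : 1 + x = (1 + z) / (1 - z) := by rw [hx]; field_simp; ring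
    have hx0 : x ≠ 0 := mul_ne_zero two_ne_zero (div_ne_zero hz0 hq)
    have h1x0 : 1 + x ≠ 0 := by rw [h1x]; exact div_ne_zero hp hq
    have hL := Complex.exp_log h1x0
    have hrem := threeTerm_remainder (f := Complex.exp (m * Complex.log (1 + x)))
      (J := lagrangeTail m x (Complex.log (1 + x))) rfl
      (exp_eq_lagrangeTail hx0 m) (lagrangeTail_recurrence hx0 hL m) (2 * m + 1)
    rw [Complex.exp_nat_mul, hL, Finset.prod_eq_zero (i := 2 * (m - 1) + 1)
      (Finset.mem_range.2 (by omega)), neg_zero, zero_mul, sub_eq_zero, h1x, div_pow] at hrem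
    · obtain ⟨e1, e2⟩ := threeTerm_euler_eq (n := m) hx' m
      rw [← hrem] at e1 e2
      have hqm : (1 - z) ^ m ≠ 0 := pow_ne_zero _ hq
      have h2mz : 2 * (m : ℂ) * z ≠ 0 := mul_ne_zero (mul_ne_zero two_ne_zero hm0) hz0
      refine mul_left_cancel₀ (mul_ne_zero h2mz hqm) ?_
      generalize threeTerm (lagrangeNum m x) lagrangeDen 0 1 (2 * m + 1) = B at *
      generalize threeTerm (eulerNum m z) eulerDen 0 1 m = b at *
      generalize threeTerm (eulerNum m z) eulerDen 1 1 m = a at *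
      generalize ((1 - z) / 2) ^ m = r at *
      generalize (1 - z) ^ m = q at *
      generalize (1 + z) ^ m = p at *
      have e1' : 2 * m * z * a * q = r * (m * z * (B * (p + q))) := by rw [e1]; field_simp
      have e2' : 2 * m * z * b * q = r * (B * (p - q)) := by rw [e2]; field_simp
      linear_combination (p - q) * e1' - m * z * (p + q) * e2'
    · rw [lagrangeNum_odd]
      push_cast [hm]
      ring
  have hdense : Dense ({0, 1, -1} : Set ℂ)ᶜ := (Set.toFinite _).countable.dense_compl ℂ
  have h1 := continuous_threeTerm_euler m 1 1 m
  have h2 := continuous_threeTerm_euler m 0 1 m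
  exact congrFun (Continuous.ext_on hdense (by fun_prop) (by fun_prop) hgen) z

theorem eulerContFract_terminatedAt {m : ℕ} {n : ℂ} (hm : 1 ≤ m) (hn : n = m ∨ n = -m) (z : ℂ) :
    (eulerContFract n z).TerminatedAt (m - 1) := by
  refine haltingContFract_terminatedAt (K := m - 1) ?_ le_rfl
  rw [Nat.cast_sub hm]
  rcases hn with rfl | rfl <;> push_cast <;> ring

theorem eulerContFract_neg (n z : ℂ) : eulerContFract (-n) z = eulerContFract n z := by
  simp [eulerContFract]

/-- The denominator cannot vanish: by the cross-multiplied identity the numerator would vanish with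
it, and so would the Casoratian. -/
theorem eulerContFract_termination_natCast {m : ℕ} (hm : 1 ≤ m) {z : ℂ}
    (h : (1 + z) ^ (m : ℂ) ≠ (1 - z) ^ (m : ℂ)) :
    (eulerContFract m z).dens (m - 1) ≠ 0 ∧
      (eulerContFract m z).convs (m - 1) = eulerLeftMember m z := by
  rw [eulerLeftMember, Complex.cpow_natCast, Complex.cpow_natCast] at *
  have hz : z ≠ 0 := by
    rintro rfl
    simp at h
  have hne : ∀ i < m - 1, eulerNum m z i ≠ 0 := by
    intro i hi h0
    rcases (eulerNum_eq_zero_iff hz i).1 h0 with h0 | h0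
    · have : m = i + 1 := by exact_mod_cast h0
      omega
    · have : m + (i + 1) = 0 := by
        have h3 : (m : ℂ) + (i + 1) = 0 := by rw [h0]; ring
        exact_mod_cast h3
      omega
  have hcas := threeTerm_casoratian_ne_zero (h := 1) (b := eulerDen) hne
  have hid := threeTerm_euler_termination hm z
  rw [eulerContFract_eq, GenContFract.conv_eq_num_div_den, haltingContFract_nums hne,
    haltingContFract_dens hne]
  rw [Nat.sub_add_cancel hm] at hcas ⊢
  have hd : (1 + z) ^ m - (1 - z) ^ m ≠ 0 := sub_ne_zero.2 h
  have hB : threeTerm (eulerNum m z) eulerDen 0 1 m ≠ 0 := by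
    intro hB
    rw [hB, mul_zero] at hid
    apply hcas
    rw [hB, (mul_eq_zero.1 hid).resolve_right hd]
    ring
  exact ⟨hB, by rw [div_eq_div_iff hB hd, hid]⟩

end Termination

theorem mainTheorem1 :
    -- Lagrange's expansion of the binomial power
    (∀ n x : ℂ, 1 + x ∈ Complex.slitPlane →
      ContFractHasValue (lagrangeContFract n x) ((1 + x) ^ n)) ∧
    -- contraction and the substitutions `x = 2 y`, `y = z / (1 - z)` turn it into Euler's fraction
    (∀ n z y x : ℂ, n ≠ 0 → z ≠ 0 → z ≠ 1 → y = z / (1 - z) → x = 2 * y → ∀ k : ℕ,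
      (lagrangeContFract n x).dens (2 * k + 2) ≠ 0 → (eulerContFract n z).dens k ≠ 0 →
        (lagrangeContFract n x).convs (2 * k + 2) ≠ 1 ∧
        n * z * ((lagrangeContFract n x).convs (2 * k + 2) + 1) /
            ((lagrangeContFract n x).convs (2 * k + 2) - 1) =
          (eulerContFract n z).convs k) ∧
    -- the main continued fraction
    (∀ n z : ℂ, 1 + z ∈ Complex.slitPlane → 1 - z ∈ Complex.slitPlane →
      (1 + z) ^ n ≠ (1 - z) ^ n →
      ContFractHasValue (eulerContFract n z) (eulerLeftMember n z)) ∧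
    -- it terminates for `n = ± m`, and then its finite value is the left member
    (∀ (m : ℕ) (n : ℂ), 1 ≤ m → (n = m ∨ n = -m) → ∀ z : ℂ,
      (eulerContFract n z).TerminatedAt (m - 1) ∧
      ((n = m ∨ (z ≠ 1 ∧ z ≠ -1)) → (1 + z) ^ n ≠ (1 - z) ^ n →
        (eulerContFract n z).dens (m - 1) ≠ 0 ∧
        (eulerContFract n z).convs (m - 1) = eulerLeftMember n z)) ∧
    -- the left member is invariant under `n → -n`
    (∀ n z : ℂ, z ≠ 1 → z ≠ -1 → (1 + z) ^ n ≠ (1 - z) ^ n →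
      (1 + z) ^ (-n) ≠ (1 - z) ^ (-n) ∧ eulerLeftMember (-n) z = eulerLeftMember n z) := by
  refine ⟨lagrangeContFract_hasValue, ?_, fun n z => eulerContFract_hasValue, ?_,
    fun n z => eulerLeftMember_neg⟩
  · rintro n z y x hn hz hz1 rfl rfl k hL hE
    have hq : 1 - z ≠ 0 := sub_ne_zero.2 hz1.symm
    obtain ⟨h1, h2⟩ := eulerContFract_convs_eq (x := 2 * (z / (1 - z))) hn hz hz1
      (by field_simp) k hL
    exact ⟨h1.1 hE, h2 (h1.1 hE)⟩
  · intro m n hm hn z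
    refine ⟨eulerContFract_terminatedAt hm hn z, fun hz hne => ?_⟩
    by_cases hnm : n = m
    · subst hnm
      exact eulerContFract_termination_natCast hm hne
    · obtain rfl := hn.resolve_left hnm
      obtain ⟨hz1, hz2⟩ := hz.resolve_left hnm
      obtain ⟨h1, h2⟩ := eulerLeftMember_neg hz1 hz2 hne
      rw [neg_neg] at h1 h2
      rw [eulerContFract_neg, ← h2]
      exact eulerContFract_termination_natCast hm h1
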